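/- **Setting.** Let $M$ be a smooth $d$-dimensional manifold (Hausdorff, second countable), $M^*=M\cup\{\partial_M\}$ its one-point compactification, $\pi:\mathbb R\times M\to\mathbb R$ the projection. A *diffusion* $X\in I_{(t_0,q)}(M)$ is a process $X=\{X(t)\}_{t\ge t_0}$ on some filtered probability space satisfying the usual conditions, adapted, with continuous paths in $M^*$, which stays in $M$ on $[t_0,\tau)$ and equals $\partial_M$ on $[\tau,\infty)$ for a stopping time $\tau>t_0$, with $X(t_0)=q$ a.s., and which solves the martingale problem for some smooth time-dependent elliptic second-order operator $A^X_t=\mathfrak b^i(t)\partial_i+\tfrac12a^{jk}(t)\partial_j\partial_k$ ($a$ symmetric positive semidefinite) on $[t_0,\infty)\times M$: for every $f\in C_c^\infty(\mathbb R\times M)$, extended by $0$ to $\partial_M$, $f(t,X(t))-f(t_0,X(t_0))-\int_{t_0}^t(\partial_s+A^X_s)f(s,X(s))\,ds$ is a martingale. Its mean derivatives at $t_0$ are $(DX,QX)(t_0)=(\mathfrak b,a)(t_0,q)$, and $D(f\circ X)(t_0)=(A^X_{t_0}f)(q)$. Two diffusions are equivalent at $(t,q)$ if both start from $q$ at time $t$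 and $D(f\circ X)(t)=D(f\circ Y)(t)$ for all $f\in C^\infty(M)$; the class of $X$ is $j_{(t,q)}X$, and the set of all classes is the model jet bundle $\mathbb R\times\mathcal T^SM$. A chart $(x^i)$ of $M$ induces the coordinates $(t,x^i,D^ix,Q^{jk}x)$ on it, with $D^ix(j_{(t,q)}X)=(DX)^i(t)=(A^X_t x^i)(q)$ and $Q^{jk}x(j_{(t,q)}X)=(QX)^{jk}(t)$. For a smooth function $f(t,x)$ the total mean derivative is $(\mathbf D_tf)(j_{(t,q)}X)=((\partial_t+A^X_t)f)(t,q)=\partial_tf+\partial_if\,D^ix+\tfrac12\partial_j\partial_kf\,Q^{jk}x$. Let $F$ be a smooth map of $\mathbb R\times M$ of the form $F(t,q)=(F^0(t),\bar F(t,q))$ with $F^0$ an increasing diffeomorphism of $\mathbb R$. The pushforward $F\cdot X$ is the process $(F\cdot X)(s)=\bar F((F^0)^{-1}(s),X((F^0)^{-1}(s)))$ with the filtration, initial time and lifetime transformed by $F^0$. If $F$ maps diffusions to diffusions, a *stochastic prolongation* of $F$ is a map $jF$ of $\mathbb R\times\mathcal T^SM$ with $jF(j_{(t,q)}X)=j_{F(t,q)}(F\cdot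 X)$ for every $X\in I_{(t,q)}(M)$. **Theorem (stochastic prolongation formulae).** Let $V$ be a smooth vector field on $\mathbb R\times M$ that is complete, i.e. generates a smooth one-parameter group (flow) $\psi=\{\psi_\varepsilon\}_{\varepsilon\in\mathbb R}$ of transformations of $\mathbb R\times M$, and $\pi$-projectable, i.e. each $\psi_\varepsilon$ maps fibres of $\pi$ to fibres of $\pi$. Write $V_{(t,q)}=V^0(t)\,\partial_t+V^i(t,q)\,\partial_{x^i}$ in local coordinates $(x^i)$ of $M$. Then each $\psi_\varepsilon$ maps diffusions to diffusions and has a unique stochastic prolongation $j\psi_\varepsilon$, and the stochastic prolongation of $V$, $$jV\big|_{\xi}=\frac{d}{d\varepsilon}\Big|_{\varepsilon=0}(j\psi_\varepsilon)(\xi),\qquad \xi\in\mathbb R\times\mathcal T^SM,$$ exists (as the velocity in the canonical coordinates $(t,x^i,D^ix,Q^{jk}x)$ induced by any chart of $M$) and is $$jV=V^0\frac{\partial}{\partial t}+V^i\frac{\partial}{\partial x^i}+V_1^i\frac{\partial}{\partial (D^ix)}+V_2^{jk}\frac{\partial}{\partial (Q^{jk}x)},$$ where $$V_1^i=\mathbf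 D_tV^i-\dot V^0\,D^ix,\qquad V_2^{jk}=\frac{\partial V^j}{\partial x^i}\,Q^{ik}x+\frac{\partial V^k}{\partial x^i}\,Q^{ij}x-\dot V^0\,Q^{jk}x .$$ -/

import Mathlib

open scoped Manifold ContDiff Topology
open MeasureTheory

namespace StochProlong

/-! ### Second-order elliptic tangent vectors -/

/-- Typical fibre `ℝ^d × Sym²₊(ℝ^d)` of the second-order elliptic tangent bundle.  As Mathlib does
for `TangentSpace`, an element of the fibre over `q` is recorded by its coefficients `(𝔟, a)` in the
preferred chart `chartAt _ q`; it stands for the operator `𝔟^i ∂_i + ½ a^{jk} ∂_j ∂_k` at `q`. -/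
@[ext]
structure EllipticVector (d : ℕ) where
  b : Fin d → ℝ
  a : Matrix (Fin d) (Fin d) ℝ
  posSemidef : a.PosSemidef

section Coordinates

variable {d : ℕ} {M : Type*} [TopologicalSpace M]

/-- The partial derivative `∂f/∂x^i` in the chart `e = (x^i)`, as a function on the domain of `e`
(it only depends on the germ of `f`). -/
noncomputable def pd (e : OpenPartialHomeomorph M (EuclideanSpace ℝ (Fin d))) (i : Fin d)
    (f : M → ℝ) (p : M) : ℝ :=
  fderiv ℝ (f ∘ e.symm) (e p) (EuclideanSpace.single i 1)

variable [ChartedSpace (EuclideanSpace ℝ (Fin d)) M]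

/-- The operator `A f = 𝔟^i ∂_i f + ½ a^{jk} ∂_j ∂_k f` of the second-order vector `A` at `q`.
It only depends on the germ of `f` at `q`. -/
noncomputable def EllipticVector.apply (A : EllipticVector d) (q : M) (f : M → ℝ) : ℝ :=
  (∑ i, A.b i * pd (chartAt (EuclideanSpace ℝ (Fin d)) q) i f q) +
    1 / 2 * ∑ j, ∑ k, A.a j k * pd (chartAt (EuclideanSpace ℝ (Fin d)) q) j
      (pd (chartAt (EuclideanSpace ℝ (Fin d)) q) k f) q

/-- The squared field operator `Γ_A(f, g) = a^{jk} ∂_j f ∂_k g` at `q`. -/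
noncomputable def EllipticVector.squaredField (A : EllipticVector d) (q : M) (f g : M → ℝ) : ℝ :=
  ∑ j, ∑ k, A.a j k * pd (chartAt (EuclideanSpace ℝ (Fin d)) q) j f q *
    pd (chartAt (EuclideanSpace ℝ (Fin d)) q) k g q

end Coordinates

/-- A second-order vector at `q` is determined by its action on smooth functions. -/
theorem EllipticVector.eq_of_apply_eq {d : ℕ} {M : Type*} [TopologicalSpace M] [T2Space M]
    [ChartedSpace (EuclideanSpace ℝ (Fin d)) M] [IsManifold (𝓡 d) ∞ M] {q : M}
    {A B : EllipticVector d}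
    (h : ∀ f : M → ℝ, ContMDiff (𝓡 d) 𝓘(ℝ, ℝ) ∞ f → A.apply q f = B.apply q f) : A = B := by
  set φ := chartAt (EuclideanSpace ℝ (Fin d)) q with hφ
  set x₀ := φ q with hx₀
  have hsymm : Filter.Tendsto φ.symm (𝓝 x₀) (𝓝 q) := by
    have := φ.continuousAt_symm (φ.map_source (mem_chart_source _ q))
    rw [ContinuousAt, φ.left_inv (mem_chart_source _ q)] at this
    exact this
  -- a smooth function of the coordinates gives an identity between coefficients
  have key : ∀ g : EuclideanSpace ℝ (Fin d) → ℝ, ContDiff ℝ ∞ g →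
      ∀ C : EllipticVector d, ∀ ρ : SmoothBumpFunction (𝓡 d) q,
      C.apply q (fun p => ρ p • g (φ p)) =
        (∑ i, C.b i * fderiv ℝ g x₀ (EuclideanSpace.single i 1)) +
        1 / 2 * ∑ j, ∑ k, C.a j k *
          fderiv ℝ (fun y => fderiv ℝ g y (EuclideanSpace.single k 1)) x₀
            (EuclideanSpace.single j 1) := by
    intro g hg C ρ
    have h1 : (fun p => ρ p • g (φ p)) ∘ φ.symm =ᶠ[𝓝 x₀] g := by
      have e1 := hsymm.eventually ρ.eventuallyEq_one
      have e2 : ∀ᶠ y in 𝓝 x₀, y ∈ φ.target :=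
        φ.open_target.mem_nhds (φ.map_source (mem_chart_source _ q))
      filter_upwards [e1, e2] with y hy1 hy2
      simp [hy1, φ.right_inv hy2]
    have h2 : ∀ k, pd φ k (fun p => ρ p • g (φ p)) ∘ φ.symm =ᶠ[𝓝 x₀]
        fun y => fderiv ℝ g y (EuclideanSpace.single k 1) := by
      intro k
      have e2 : ∀ᶠ y in 𝓝 x₀, y ∈ φ.target :=
        φ.open_target.mem_nhds (φ.map_source (mem_chart_source _ q))
      filter_upwards [h1.eventuallyEq_nhds, e2] with y hy1 hy2
      simp only [Function.comp_apply, pd, φ.right_inv hy2]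
      rw [Filter.EventuallyEq.fderiv_eq hy1]
    unfold EllipticVector.apply
    congr 1
    · refine Finset.sum_congr rfl fun i _ => ?_
      rw [← hφ]
      simp only [pd]
      rw [Filter.EventuallyEq.fderiv_eq h1]
    · congr 1
      refine Finset.sum_congr rfl fun j _ => Finset.sum_congr rfl fun k _ => ?_
      rw [← hφ]
      conv_lhs => rw [pd]
      rw [Filter.EventuallyEq.fderiv_eq (h2 k)]
  have hsm : ∀ g : EuclideanSpace ℝ (Fin d) → ℝ, ContDiff ℝ ∞ g →
      ∀ ρ : SmoothBumpFunction (𝓡 d) q,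
      ContMDiff (𝓡 d) 𝓘(ℝ, ℝ) ∞ (fun p => ρ p • g (φ p)) := by
    intro g hg ρ
    refine ρ.contMDiff_smul ?_
    exact hg.contMDiff.comp_contMDiffOn (contMDiffOn_chart (I := 𝓡 d) (n := ∞) (x := q))
  obtain ⟨ρ⟩ : Nonempty (SmoothBumpFunction (𝓡 d) q) := inferInstance
  have hall : ∀ g : EuclideanSpace ℝ (Fin d) → ℝ, ContDiff ℝ ∞ g → _ := fun g hg =>
    ((key g hg A ρ).symm.trans (h _ (hsm g hg ρ))).trans (key g hg B ρ)
  -- linear coordinates give `b`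
  have hb : A.b = B.b := by
    funext l
    have := hall (fun y => y l) (by fun_prop)
    have hd : ∀ y : EuclideanSpace ℝ (Fin d), fderiv ℝ (fun y : EuclideanSpace ℝ (Fin d) => y l) y =
        EuclideanSpace.proj l := fun y =>
      ((EuclideanSpace.proj l : EuclideanSpace ℝ (Fin d) →L[ℝ] ℝ)).fderiv
    simp only [hd] at this
    simpa [Pi.single_apply] using this
  have ha : A.a = B.a := by
    have hsA : ∀ C : EllipticVector d, ∀ l m, C.a m l = C.a l m := fun C l m => by
      have := C.posSemidef.1.apply l m
      simpa using this
    ext l m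
    have := hall (fun y => y l * y m) (by fun_prop)
    have hd : ∀ y : EuclideanSpace ℝ (Fin d),
        fderiv ℝ (fun y : EuclideanSpace ℝ (Fin d) => y l * y m) y =
          y l • EuclideanSpace.proj m + y m • EuclideanSpace.proj l := fun y =>
      ((((EuclideanSpace.proj l : EuclideanSpace ℝ (Fin d) →L[ℝ] ℝ)).hasFDerivAt (x := y)).mul
        (((EuclideanSpace.proj m : EuclideanSpace ℝ (Fin d) →L[ℝ] ℝ)).hasFDerivAt (x := y))).fderiv
    have hd2 : ∀ k j : Fin d, fderiv ℝ (fun y : EuclideanSpace ℝ (Fin d) =>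
        fderiv ℝ (fun y : EuclideanSpace ℝ (Fin d) => y l * y m) y (EuclideanSpace.single k 1)) x₀
          (EuclideanSpace.single j 1) =
        (if l = j then 1 else 0) * (if m = k then 1 else 0) +
          (if m = j then 1 else 0) * (if l = k then 1 else 0) := by
      intro k j
      have : (fun y : EuclideanSpace ℝ (Fin d) =>
        fderiv ℝ (fun y : EuclideanSpace ℝ (Fin d) => y l * y m) y (EuclideanSpace.single k 1)) =
        fun y => y l * (if m = k then 1 else 0) + y m * (if l = k then 1 else 0) := by
        funext y
        rw [hd]
        simp
      rw [this]
      have h3 : HasFDerivAt (fun y : EuclideanSpace ℝ (Fin d) =>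
          y l * (if m = k then (1 : ℝ) else 0) + y m * (if l = k then (1 : ℝ) else 0))
          ((if m = k then (1 : ℝ) else 0) • (EuclideanSpace.proj l : EuclideanSpace ℝ (Fin d) →L[ℝ] ℝ)
            + (if l = k then (1 : ℝ) else 0) •
              (EuclideanSpace.proj m : EuclideanSpace ℝ (Fin d) →L[ℝ] ℝ)) x₀ :=
        ((((EuclideanSpace.proj l : EuclideanSpace ℝ (Fin d) →L[ℝ] ℝ)).hasFDerivAt
            (x := x₀)).mul_const _).add
        ((((EuclideanSpace.proj m : EuclideanSpace ℝ (Fin d) →L[ℝ] ℝ)).hasFDerivAt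
            (x := x₀)).mul_const _)
      rw [h3.fderiv]
      simp only [_root_.add_apply, _root_.smul_apply, PiLp.proj_apply,
        PiLp.single_apply, smul_eq_mul]
      ring
    simp only [hd2] at this
    rw [hb] at this
    have h4 := add_left_cancel this
    have h5 : ∀ C : EllipticVector d, (∑ j, ∑ k, C.a j k *
        ((if l = j then (1 : ℝ) else 0) * (if m = k then 1 else 0) +
          (if m = j then 1 else 0) * (if l = k then 1 else 0))) = 2 * C.a l m := by
      intro C
      simp only [mul_add, Finset.sum_add_distrib]
      simp [hsA C l m, two_mul]
    rw [h5, h5] at h4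
    linarith
  exact EllipticVector.ext hb ha

/-! ### Diffusions -/

/-- A process on some filtered probability space, started at time `t₀`, with values in the one-point
compactification `M* = M ∪ {∂_M}`, and a candidate lifetime `τ`. -/
structure PathProcess (M : Type*) where
  Ω : Type
  [mΩ : MeasurableSpace Ω]
  P : Measure Ω
  [isProb : IsProbabilityMeasure P]
  /-- the past filtration -/
  𝓟 : Filtration ℝ mΩ
  t₀ : ℝ
  τ : Ω → WithTop ℝ
  X : ℝ → Ω → OnePoint M

attribute [instance] PathProcess.mΩ PathProcess.isProb

/-- Extension of a function on `ℝ × M` to `ℝ × M*` by zero at the cemetery point. -/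
def extendZero {M : Type*} (f : ℝ × M → ℝ) (t : ℝ) (x : OnePoint M) : ℝ :=
  x.elim 0 fun y => f (t, y)

section Diffusions

variable {d : ℕ} {M : Type*} [TopologicalSpace M] [ChartedSpace (EuclideanSpace ℝ (Fin d)) M]

/-- `((∂_t + A_t) f)(t, q)` for a time-dependent elliptic second-order operator `A`. -/
noncomputable def spaceTimeOp (A : ℝ → M → EllipticVector d) (f : ℝ × M → ℝ) (p : ℝ × M) : ℝ :=
  deriv (fun s => f (s, p.2)) p.1 + (A p.1 p.2).apply p.2 fun y => f (p.1, y)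

/-- `A` is a smooth time-dependent second-order elliptic operator on `[t₀, ∞) × M`. -/
def IsSmoothOperator (t₀ : ℝ) (A : ℝ → M → EllipticVector d) : Prop :=
  ∀ f : ℝ × M → ℝ, ContMDiff (𝓘(ℝ, ℝ).prod (𝓡 d)) 𝓘(ℝ, ℝ) ∞ f →
    ContMDiffOn (𝓘(ℝ, ℝ).prod (𝓡 d)) 𝓘(ℝ, ℝ) ∞
      (fun p : ℝ × M => (A p.1 p.2).apply p.2 fun y => f (p.1, y)) (Set.Ici t₀ ×ˢ Set.univ)

/-- The process
`M^{f,X}(t) = f(t, X(t)) - f(t₀, X(t₀)) - ∫_{t₀}^t (∂_s + A_s) f(s, X(s)) ds`, `t ≥ t₀`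
(frozen at its initial value `0` for `t ≤ t₀`). -/
noncomputable def martingaleProcess (X : PathProcess M) (A : ℝ → M → EllipticVector d) (f : ℝ × M → ℝ)
    (t : ℝ) (w : X.Ω) : ℝ :=
  extendZero f (max t X.t₀) (X.X (max t X.t₀) w) - extendZero f X.t₀ (X.X X.t₀ w) -
    ∫ s in X.t₀..max t X.t₀, extendZero (spaceTimeOp A f) s (X.X s w)

/-- `A` is a generator of `X`: `X` solves the martingale problem for `A`.  The test functions are
smooth with compact support in `ℝ × M`, for which `M^{f,X}` is a bounded martingale on bounded time
intervals and needs no localization. -/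
def IsGenerator (X : PathProcess M) (A : ℝ → M → EllipticVector d) : Prop :=
  IsSmoothOperator X.t₀ A ∧
    ∀ f : ℝ × M → ℝ, ContMDiff (𝓘(ℝ, ℝ).prod (𝓡 d)) 𝓘(ℝ, ℝ) ∞ f → HasCompactSupport f →
      Martingale (martingaleProcess X A f) X.𝓟 X.P

variable (d) in
/-- `X` is an `M`-valued diffusion process starting from `q` at its initial time. -/
structure IsDiffusionFrom (X : PathProcess M) (q : M) : Prop where
  /-- the filtration satisfies the usual conditions: it is right-continuous ... -/
  rightCont : X.𝓟.IsRightContinuous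
  /-- ... and contains all null sets -/
  complete : ∀ (t : ℝ) (s : Set X.Ω), X.P s = 0 → MeasurableSet[X.𝓟 t] s
  stoppingTime : IsStoppingTime X.𝓟 X.τ
  lifetime_pos : ∀ w, (X.t₀ : WithTop ℝ) < X.τ w
  adapted : ∀ t, X.t₀ ≤ t → @Measurable X.Ω (OnePoint M) (X.𝓟 t) (borel (OnePoint M)) (X.X t)
  continuous : ∀ w, ContinuousOn (fun t => X.X t w) (Set.Ici X.t₀)
  alive_iff : ∀ w t, X.t₀ ≤ t → (X.X t w ≠ OnePoint.infty ↔ (t : WithTop ℝ) < X.τ w)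
  start : ∀ᵐ w ∂X.P, X.X X.t₀ w = (q : OnePoint M)
  exists_generator : ∃ A : ℝ → M → EllipticVector d, IsGenerator X A

variable (d M) in
/-- The diffusions `X ∈ I_{(t,q)}(M)`, for all `(t, q) ∈ ℝ × M`. -/
structure Diffusion where
  proc : PathProcess M
  q : M
  isDiffusionFrom : IsDiffusionFrom d proc q

/-- The generator `A^X` of a diffusion. -/
noncomputable def Diffusion.generator (X : Diffusion d M) : ℝ → M → EllipticVector d :=
  X.isDiffusionFrom.exists_generator.choose

/-- The mean derivatives `(DX(t), QX(t)) = A^X_{(t,q)}` of `X ∈ I_{(t,q)}(M)` at its initial time.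
This value is determined by the process, not by the choice of the generator. -/
noncomputable def Diffusion.meanDeriv (X : Diffusion d M) : EllipticVector d :=
  X.generator X.proc.t₀ X.q

/-- The mean derivative `D(f ∘ X)(t) = (A^X f)(t, q)` of `f ∘ X`, for `X ∈ I_{(t,q)}(M)`. -/
noncomputable def Diffusion.meanDerivComp (X : Diffusion d M) (f : M → ℝ) : ℝ :=
  X.meanDeriv.apply X.q f

variable (d M) in
/-- Stochastic equivalence of diffusions at `(t, q)`. -/
def stochEquiv : Setoid (Diffusion d M) where
  r X Y := X.proc.t₀ = Y.proc.t₀ ∧ X.q = Y.q ∧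
    ∀ f : M → ℝ, ContMDiff (𝓡 d) 𝓘(ℝ, ℝ) ∞ f → X.meanDerivComp f = Y.meanDerivComp f
  iseqv :=
    { refl := fun _ => ⟨rfl, rfl, fun _ _ => rfl⟩
      symm := fun h => ⟨h.1.symm, h.2.1.symm, fun f hf => (h.2.2 f hf).symm⟩
      trans := fun h k => ⟨h.1.trans k.1, h.2.1.trans k.2.1,
        fun f hf => (h.2.2 f hf).trans (k.2.2 f hf)⟩ }

variable (d M) in
/-- The model jet bundle `{ j_{(t,q)} X : X ∈ I_{(t,q)}(M) } ≅ ℝ × 𝒯^S M`. -/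
def Jet := Quotient (stochEquiv d M)

/-- The class `j_{(t,q)} X` of `X ∈ I_{(t,q)}(M)`. -/
def jet (X : Diffusion d M) : Jet d M := Quotient.mk (stochEquiv d M) X

/-- The coordinate `t` on the model jet bundle. -/
def Jet.time (ξ : Jet d M) : ℝ :=
  Quotient.lift (fun X : Diffusion d M => X.proc.t₀) (fun _ _ h => And.left h) ξ

/-- The base point `q` of `j_{(t,q)} X`. -/
def Jet.point (ξ : Jet d M) : M :=
  Quotient.lift (fun X : Diffusion d M => X.q) (fun _ _ h => And.left (And.right h)) ξ

/-- The correspondence `j_{(t,q)} X ↦ (DX(t), QX(t))`. -/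
noncomputable def Jet.vec [T2Space M] [IsManifold (𝓡 d) ∞ M] (ξ : Jet d M) : EllipticVector d :=
  Quotient.lift (fun X : Diffusion d M => X.meanDeriv)
    (fun X _ h => EllipticVector.eq_of_apply_eq (q := X.q) fun f hf => by
      obtain ⟨_, hq, h2⟩ := h
      have h3 := h2 f hf
      unfold Diffusion.meanDerivComp at h3
      rwa [← hq] at h3) ξ

/-- The canonical coordinate `D^i x` induced by the chart `e = (x^i)`. -/
noncomputable def Jet.D [T2Space M] [IsManifold (𝓡 d) ∞ M] (ξ : Jet d M)
    (e : OpenPartialHomeomorph M (EuclideanSpace ℝ (Fin d))) (i : Fin d) : ℝ :=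
  ξ.vec.apply ξ.point fun p => e p i

/-- The canonical coordinate `Q^{jk} x` induced by the chart `e = (x^i)`. -/
noncomputable def Jet.Q [T2Space M] [IsManifold (𝓡 d) ∞ M] (ξ : Jet d M)
    (e : OpenPartialHomeomorph M (EuclideanSpace ℝ (Fin d))) (j k : Fin d) : ℝ :=
  ξ.vec.squaredField ξ.point (fun p => e p j) fun p => e p k

/-- The total mean derivative `(𝐃_t f)(j_{(t,q)} X) = D[f(t, X(t))] = ((∂_t + A^X) f)(t, q)` of a
function defined near `(t, q)`. -/
noncomputable def totalMeanDeriv [T2Space M] [IsManifold (𝓡 d) ∞ M] (f : ℝ × M → ℝ)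
    (ξ : Jet d M) : ℝ :=
  deriv (fun s => f (s, ξ.point)) ξ.time + ξ.vec.apply ξ.point fun y => f (ξ.time, y)

end Diffusions

/-! ### Pushforwards and prolongations -/

/-- The pushforward `F·X` by a bundle map `F` of `ℝ × M` projecting to `F₀`:
`(F·X)(s) = F̄(F₀⁻¹(s), X(F₀⁻¹(s)))`, with the filtration `𝓟_{F₀⁻¹(s)}`, the initial time `F₀(t₀)` and
the lifetime `F₀(τ)`. -/
def PathProcess.pushforward {M : Type*} (X : PathProcess M) (F : ℝ × M → ℝ × M) (F₀ : ℝ ≃o ℝ) :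
    PathProcess M where
  Ω := X.Ω
  P := X.P
  𝓟 :=
    { seq := fun s => X.𝓟 (F₀.symm s)
      mono' := fun _ _ h => X.𝓟.mono (F₀.symm.monotone h)
      le' := fun s => X.𝓟.le (F₀.symm s) }
  t₀ := F₀ X.t₀
  τ := fun w => (X.τ w).map F₀
  X := fun s w => (X.X (F₀.symm s) w).map fun y => (F (F₀.symm s, y)).2

section Prolongation

variable {d : ℕ} {M : Type*} [TopologicalSpace M] [ChartedSpace (EuclideanSpace ℝ (Fin d)) M]

/-- `jF` is the stochastic prolongation of `F`: the map `F` of `ℝ × M` projects to an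
(orientation preserving) diffeomorphism `F₀` of `ℝ`, it transforms diffusions into diffusions, and
`jF (j_{(t,q)} X) = j_{F(t,q)} (F·X)`. -/
def IsStochasticProlongation (F : ℝ × M → ℝ × M) (jF : Jet d M → Jet d M) : Prop :=
  ∃ F₀ : ℝ ≃o ℝ, ContDiff ℝ ∞ F₀ ∧ ContDiff ℝ ∞ F₀.symm ∧ (∀ p, (F p).1 = F₀ p.1) ∧
    ∀ X : Diffusion d M,
      ∃ h : IsDiffusionFrom d (X.proc.pushforward F F₀) (F (X.proc.t₀, X.q)).2,
        jF (jet X) = jet ⟨X.proc.pushforward F F₀, (F (X.proc.t₀, X.q)).2, h⟩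

/-- `ψ` is the one-parameter group of transformations of `ℝ × M` generated by `V`, i.e. `V` is
complete and `ψ` is its flow. -/
structure IsCompleteWithFlow
    (V : (p : ℝ × M) → TangentSpace (𝓘(ℝ, ℝ).prod (𝓡 d)) p) (ψ : ℝ → ℝ × M → ℝ × M) : Prop where
  smooth : ContMDiff (𝓘(ℝ, ℝ).prod (𝓘(ℝ, ℝ).prod (𝓡 d))) (𝓘(ℝ, ℝ).prod (𝓡 d)) ∞
    fun x : ℝ × ℝ × M => ψ x.1 x.2
  zero : ∀ p, ψ 0 p = p
  add : ∀ ε δ p, ψ (ε + δ) p = ψ ε (ψ δ p)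
  integralCurve : ∀ p, IsMIntegralCurve (fun ε => ψ ε p) V

/-- A vector field with flow `ψ` is `π`-projectable if each `ψ_ε` maps fibres of
`π : ℝ × M → ℝ` to fibres. -/
def IsProjectable (ψ : ℝ → ℝ × M → ℝ × M) : Prop :=
  ∀ ε, ∃ F₀ : ℝ → ℝ, ∀ p, (ψ ε p).1 = F₀ p.1

/-- The component `V^i = dx^i(V)` of a vector field on `ℝ × M` in the chart `e = (x^i)` of `M`. -/
noncomputable def component (V : (p : ℝ × M) → TangentSpace (𝓘(ℝ, ℝ).prod (𝓡 d)) p)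
    (e : OpenPartialHomeomorph M (EuclideanSpace ℝ (Fin d))) (i : Fin d) (p : ℝ × M) : ℝ :=
  mfderiv (𝓘(ℝ, ℝ).prod (𝓡 d)) 𝓘(ℝ, ℝ) (fun p' : ℝ × M => e p'.2 i) p (V p)

/-- In the canonical coordinates `(t, x^i, D^i x, Q^{jk} x)` induced by the chart `e` of `M`, the
curve `c` in the model jet bundle has at `ε = 0` the position `ξ` and the velocity
`v₀ ∂/∂t + v^i ∂/∂x^i + v₁^i ∂/∂(D^i x) + v₂^{jk} ∂/∂(Q^{jk} x)`. -/
structure HasVelocity [T2Space M] [IsManifold (𝓡 d) ∞ M]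
    (e : OpenPartialHomeomorph M (EuclideanSpace ℝ (Fin d))) (c : ℝ → Jet d M) (ξ : Jet d M)
    (v₀ : ℝ) (v v₁ : Fin d → ℝ) (v₂ : Fin d → Fin d → ℝ) : Prop where
  position : c 0 = ξ
  eventually_mem : ∀ᶠ ε in 𝓝 (0 : ℝ), (c ε).point ∈ e.source
  time : HasDerivAt (fun ε => (c ε).time) v₀ 0
  point : ∀ i, HasDerivAt (fun ε => e (c ε).point i) (v i) 0
  mean : ∀ i, HasDerivAt (fun ε => (c ε).D e i) (v₁ i) 0
  quad : ∀ j k, HasDerivAt (fun ε => (c ε).Q e j k) (v₂ j k) 0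

end Prolongation

end StochProlong

/-!
For a diffeomorphism `F` of `ℝ × M` covering an increasing diffeomorphism `F₀` of the time axis, the
martingale of a test function `f` along `F·X` is the martingale of `f ∘ F` along `X`, run with the
clock `F₀⁻¹`.  Hence, if `A` generates `X`, the process `F·X` is a diffusion whose generator `T` is
determined by `F₀' (∂_s + T) f ∘ F = (∂_t + A)(f ∘ F)`.  That such a `T` exists as an elliptic
second-order operator is the second-order chain rule (`EllipticVector.apply_comp`,
`EllipticVector.transport_apply`); the change of clock is
`IsBundleDiffeo.martingaleProcess_pushforward`, and `IsBundleDiffeo.isDiffusionFrom_pushforward`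
collects the remaining properties of a diffusion.

The mean derivatives are defined through an arbitrary choice of generator, so it has to be known that
any two generators of a diffusion agree at its starting point: their difference applied to a test
function has mean zero when integrated along the path over `[t₀, t]`, and one divides by `t - t₀`
(`IsGenerator.eq_at_start`).  The jet of `F·X` therefore depends only on the jet of `X`, which gives
the prolongation `jF`; in coordinates, with `A` the second-order vector of the jet at `(t, q)`,
`F₀' Dⁱx(jF ξ) = (∂_t + A)(xⁱ ∘ F)` and `F₀' Qʲᵏx(jF ξ) = Γ_A(xʲ ∘ F, xᵏ ∘ F)`.

Each map `ψ_ε` of the flow is such an `F` (`IsCompleteWithFlow.exists_isBundleDiffeo`), and the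
formulae follow by differentiating these two identities at `ε = 0`, where `F₀' = 1`.  The
derivative in `ε` commutes with `∂_t` and `A`, and with `Γ_A` in each argument, since these only
involve derivatives in `t` and `x` (`hasDerivAt_deriv_comm`, `EllipticVector.hasDerivAt_apply`,
`EllipticVector.hasDerivAt_squaredField`); it turns `xⁱ ∘ ψ_ε` into `Vⁱ` and `F₀'` into the derivative of `V⁰`.  Finally
`Γ_A(Vʲ, xᵏ) = ∂_i Vʲ Γ_A(xⁱ, xᵏ)` (`EllipticVector.squaredField_eq_sum_pd`).
-/

namespace StochProlong

/-! ### Directional derivatives -/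

section Directional

variable {W W' : Type*} [NormedAddCommGroup W] [NormedSpace ℝ W] [NormedAddCommGroup W']
  [NormedSpace ℝ W'] {d : ℕ}

/-- The derivative of `u` in the constant direction `v`, as a function of the point. -/
noncomputable def dirDeriv (v : W) (u : W → ℝ) (w : W) : ℝ := fderiv ℝ u w v

theorem dirDeriv_congr {u u' : W → ℝ} {w : W} (h : u =ᶠ[𝓝 w] u') (v : W) :
    dirDeriv v u =ᶠ[𝓝 w] dirDeriv v u' :=
  h.eventuallyEq_nhds.mono fun _ hx => by rw [dirDeriv, dirDeriv, hx.fderiv_eq]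

theorem contDiffAt_dirDeriv {u : W → ℝ} {w : W} (h : ContDiffAt ℝ ∞ u w) (v : W) :
    ContDiffAt ℝ ∞ (dirDeriv v u) w :=
  (h.fderiv_right (m := ∞) (by simp)).clm_apply contDiffAt_const

theorem eventually_differentiableAt_of_contDiffAt {u : W → W'} {w : W} (h : ContDiffAt ℝ ∞ u w) :
    ∀ᶠ x in 𝓝 w, DifferentiableAt ℝ u x := by
  have h1 : ContDiffAt ℝ 1 u w := h.of_le (by exact_mod_cast le_top)
  exact (h1.eventually (by simp)).mono fun x hx => hx.differentiableAt (by simp)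

theorem dirDeriv_comm {u : W → ℝ} {w : W} (h : ContDiffAt ℝ ∞ u w) (v v' : W) :
    dirDeriv v (dirDeriv v' u) w = dirDeriv v' (dirDeriv v u) w := by
  have hd : DifferentiableAt ℝ (fderiv ℝ u) w :=
    (h.fderiv_right (m := ∞) (by simp)).differentiableAt (by simp)
  have key : ∀ a b : W, dirDeriv a (dirDeriv b u) w = fderiv ℝ (fderiv ℝ u) w a b := by
    intro a b
    have : HasFDerivAt (dirDeriv b u) _ w := hd.hasFDerivAt.clm_apply (hasFDerivAt_const b w)
    rw [dirDeriv, this.fderiv]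
    simp
  rw [key, key]
  exact h.isSymmSndFDerivAt (by simpa using ENat.LEInfty.out) v v'

/-- Restriction to an affine subspace, parametrized by `ι` with derivative `L`. -/
theorem dirDeriv_slice {u : W → ℝ} {ι : W' → W} {L : W' →L[ℝ] W}
    (hι : ∀ x, HasFDerivAt ι L x) {x : W'} (h : ContDiffAt ℝ ∞ u (ι x)) (v : W') :
    dirDeriv v (u ∘ ι) =ᶠ[𝓝 x] dirDeriv (L v) u ∘ ι := by
  have hev := (hι x).continuousAt.eventually (eventually_differentiableAt_of_contDiffAt h)
  filter_upwards [hev] with y hy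
  rw [dirDeriv, (hy.hasFDerivAt.comp y (hι y)).fderiv]
  rfl

theorem dirDeriv_dirDeriv_slice {u : W → ℝ} {ι : W' → W} {L : W' →L[ℝ] W}
    (hι : ∀ x, HasFDerivAt ι L x) {x : W'} (h : ContDiffAt ℝ ∞ u (ι x)) (v v' : W') :
    dirDeriv v (dirDeriv v' (u ∘ ι)) x = dirDeriv (L v) (dirDeriv (L v') u) (ι x) := by
  rw [(dirDeriv_congr (dirDeriv_slice hι h v') v).eq_of_nhds]
  exact (dirDeriv_slice hι (contDiffAt_dirDeriv h _) v).eq_of_nhds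

theorem sum_smul_single (z : EuclideanSpace ℝ (Fin d)) :
    z = ∑ l, z l • EuclideanSpace.single l (1 : ℝ) := by
  ext i
  simp [Pi.single_apply]

theorem dirDeriv_comp {G : EuclideanSpace ℝ (Fin d) → ℝ} {H : W → EuclideanSpace ℝ (Fin d)} {x : W}
    (hG : DifferentiableAt ℝ G (H x)) (hH : DifferentiableAt ℝ H x) (v : W) :
    dirDeriv v (G ∘ H) x = ∑ l, dirDeriv (EuclideanSpace.single l 1) G (H x) *
      dirDeriv v (fun y => H y l) x := by
  have hl : ∀ l, dirDeriv v (fun y => H y l) x = (fderiv ℝ H x v) l := by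
    intro l
    have := ((EuclideanSpace.proj l : EuclideanSpace ℝ (Fin d) →L[ℝ] ℝ).hasFDerivAt
      (x := H x)).comp x hH.hasFDerivAt
    exact congrArg (fun T : W →L[ℝ] ℝ => T v) this.fderiv
  have h1 : dirDeriv v (G ∘ H) x = fderiv ℝ G (H x) (fderiv ℝ H x v) := by
    rw [dirDeriv, fderiv_comp x hG hH]; rfl
  rw [h1]
  conv_lhs => rw [sum_smul_single (fderiv ℝ H x v)]
  simp only [map_sum, map_smul, smul_eq_mul, hl]
  exact Finset.sum_congr rfl fun l _ => mul_comm _ _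

theorem contDiffAt_coord {n : WithTop ℕ∞} {H : W → EuclideanSpace ℝ (Fin d)} {x : W}
    (hH : ContDiffAt ℝ n H x) (l : Fin d) : ContDiffAt ℝ n (fun y => H y l) x :=
  (EuclideanSpace.proj l : EuclideanSpace ℝ (Fin d) →L[ℝ] ℝ).contDiff.contDiffAt.comp x hH

/-- The second-order chain rule. -/
theorem dirDeriv_dirDeriv_comp {G : EuclideanSpace ℝ (Fin d) → ℝ}
    {H : W → EuclideanSpace ℝ (Fin d)} {x : W}
    (hG : ContDiffAt ℝ ∞ G (H x)) (hH : ContDiffAt ℝ ∞ H x) (v w : W) :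
    dirDeriv v (dirDeriv w (G ∘ H)) x =
      (∑ l, dirDeriv (EuclideanSpace.single l 1) G (H x) *
        dirDeriv v (dirDeriv w fun y => H y l) x) +
      ∑ l, ∑ m, dirDeriv (EuclideanSpace.single l 1)
          (dirDeriv (EuclideanSpace.single m 1) G) (H x) *
        (dirDeriv v (fun y => H y l) x * dirDeriv w (fun y => H y m) x) := by
  have hev : dirDeriv w (G ∘ H) =ᶠ[𝓝 x] fun y =>
      ∑ l, dirDeriv (EuclideanSpace.single l 1) G (H y) * dirDeriv w (fun y => H y l) y := by
    filter_upwards [hH.continuousAt.eventually (eventually_differentiableAt_of_contDiffAt hG),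
      eventually_differentiableAt_of_contDiffAt hH] with y h1 h2
    exact dirDeriv_comp h1 h2 w
  rw [(dirDeriv_congr hev v).eq_of_nhds]
  have hHd : DifferentiableAt ℝ H x := hH.differentiableAt (by simp)
  have h1 : ∀ l : Fin d, DifferentiableAt ℝ (dirDeriv (EuclideanSpace.single l (1 : ℝ)) G) (H x) :=
    fun l => (contDiffAt_dirDeriv hG _).differentiableAt (by simp)
  have h2 : ∀ l, DifferentiableAt ℝ (dirDeriv w fun y => H y l) x := fun l =>
    (contDiffAt_dirDeriv (contDiffAt_coord hH l) _).differentiableAt (by simp)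
  have h3 : ∀ l : Fin d, DifferentiableAt ℝ
      (fun y => dirDeriv (EuclideanSpace.single l (1 : ℝ)) G (H y)) x := fun l =>
    (h1 l).comp x hHd
  have hsum := HasFDerivAt.fun_sum (u := Finset.univ)
    fun l _ => (h3 l).hasFDerivAt.mul (h2 l).hasFDerivAt
  rw [dirDeriv, HasFDerivAt.fderiv (f := fun y => ∑ l,
    dirDeriv (EuclideanSpace.single l 1) G (H y) * dirDeriv w (fun y => H y l) y) hsum]
  simp only [sum_apply, _root_.add_apply, _root_.smul_apply, smul_eq_mul, Finset.sum_add_distrib]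
  congr 1
  rw [Finset.sum_comm]
  refine Finset.sum_congr rfl fun m _ => ?_
  have := dirDeriv_comp (h1 m) hHd v
  simp only [dirDeriv, Function.comp_def] at this ⊢
  rw [this, Finset.mul_sum]
  exact Finset.sum_congr rfl fun l _ => by ring

end Directional

/-! ### Second-order operators in a chart -/

theorem sum_four_comm {ι : Type*} [Fintype ι] (f : ι → ι → ι → ι → ℝ) :
    ∑ j, ∑ k, ∑ l, ∑ m, f j k l m = ∑ l, ∑ m, ∑ j, ∑ k, f j k l m := by
  calc _ = ∑ j, ∑ l, ∑ k, ∑ m, f j k l m := Finset.sum_congr rfl fun j _ => Finset.sum_comm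
    _ = ∑ l, ∑ j, ∑ k, ∑ m, f j k l m := Finset.sum_comm
    _ = ∑ l, ∑ j, ∑ m, ∑ k, f j k l m :=
      Finset.sum_congr rfl fun l _ => Finset.sum_congr rfl fun j _ => Finset.sum_comm
    _ = _ := Finset.sum_congr rfl fun l _ => Finset.sum_comm

section Chart

variable {d : ℕ} {M : Type*} [TopologicalSpace M]

theorem pd_congr {e : OpenPartialHomeomorph M (EuclideanSpace ℝ (Fin d))} {q : M}
    (hq : q ∈ e.source) {f g : M → ℝ} (h : f =ᶠ[𝓝 q] g) (i : Fin d) : pd e i f q = pd e i g q := by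
  have : f ∘ e.symm =ᶠ[𝓝 (e q)] g ∘ e.symm := by
    have h1 := e.continuousAt_symm (e.map_source hq)
    rw [ContinuousAt, e.left_inv hq] at h1
    exact h1.eventually h
  rw [pd, pd, this.fderiv_eq]

theorem pd_eventuallyEq {e : OpenPartialHomeomorph M (EuclideanSpace ℝ (Fin d))} {q : M}
    (hq : q ∈ e.source) {f g : M → ℝ} (h : f =ᶠ[𝓝 q] g) (i : Fin d) :
    pd e i f =ᶠ[𝓝 q] pd e i g := by
  filter_upwards [h.eventuallyEq_nhds, e.open_source.mem_nhds hq] with p hp hp'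
  exact pd_congr hp' hp i

theorem pd_pd {e : OpenPartialHomeomorph M (EuclideanSpace ℝ (Fin d))} {q : M}
    (hq : q ∈ e.source) (f : M → ℝ) (j k : Fin d) :
    pd e j (pd e k f) q = dirDeriv (EuclideanSpace.single j 1)
      (dirDeriv (EuclideanSpace.single k 1) (f ∘ e.symm)) (e q) := by
  have : pd e k f ∘ e.symm =ᶠ[𝓝 (e q)] dirDeriv (EuclideanSpace.single k 1) (f ∘ e.symm) := by
    filter_upwards [e.open_target.mem_nhds (e.map_source hq)] with y hy
    simp only [Function.comp_apply, pd, e.right_inv hy]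
    rfl
  exact (dirDeriv_congr this (EuclideanSpace.single j 1)).eq_of_nhds

variable [ChartedSpace (EuclideanSpace ℝ (Fin d)) M]

theorem EllipticVector.apply_congr (A : EllipticVector d) {q : M} {f g : M → ℝ}
    (h : f =ᶠ[𝓝 q] g) : A.apply q f = A.apply q g := by
  have hq := mem_chart_source (EuclideanSpace ℝ (Fin d)) q
  simp only [apply, pd_congr hq h, pd_congr hq (pd_eventuallyEq hq h _)]

theorem EllipticVector.squaredField_congr (A : EllipticVector d) {q : M} {f g f' g' : M → ℝ}
    (h : f =ᶠ[𝓝 q] f') (h' : g =ᶠ[𝓝 q] g') :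
    A.squaredField q f g = A.squaredField q f' g' := by
  have hq := mem_chart_source (EuclideanSpace ℝ (Fin d)) q
  simp only [squaredField, pd_congr hq h, pd_congr hq h']

theorem EllipticVector.squaredField_comm (A : EllipticVector d) (q : M) (f g : M → ℝ) :
    A.squaredField q f g = A.squaredField q g f := by
  have hs : ∀ l m, A.a m l = A.a l m := fun l m => by simpa using A.posSemidef.1.apply l m
  rw [squaredField, Finset.sum_comm, squaredField]
  exact Finset.sum_congr rfl fun j _ => Finset.sum_congr rfl fun k _ => by rw [hs]; ring

theorem EllipticVector.apply_const (A : EllipticVector d) (q : M) (c : ℝ) :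
    A.apply q (fun _ => c) = 0 := by
  have h1 : ∀ (c : ℝ) i, pd (chartAt (EuclideanSpace ℝ (Fin d)) q) i (fun _ => c) = fun _ => 0 := by
    intro c i
    funext p
    simp [pd, Function.comp_def]
  simp [apply, h1]

theorem contDiffAt_comp_symm {N : Type*} [NormedAddCommGroup N] [NormedSpace ℝ N]
    {e : OpenPartialHomeomorph M (EuclideanSpace ℝ (Fin d))}
    (he : e ∈ IsManifold.maximalAtlas (𝓡 d) ∞ M) {q : M} (hq : q ∈ e.source) {f : M → N}
    (hf : ContMDiffAt (𝓡 d) 𝓘(ℝ, N) ∞ f q) : ContDiffAt ℝ ∞ (f ∘ e.symm) (e q) := by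
  rw [← contMDiffAt_iff_contDiffAt]
  refine ContMDiffAt.comp (e q) (I' := 𝓡 d) ?_
    (contMDiffAt_symm_of_mem_maximalAtlas he (e.map_source hq))
  rwa [e.left_inv hq]

theorem contMDiffAt_of_comp_symm {N : Type*} [NormedAddCommGroup N] [NormedSpace ℝ N]
    {e : OpenPartialHomeomorph M (EuclideanSpace ℝ (Fin d))}
    (he : e ∈ IsManifold.maximalAtlas (𝓡 d) ∞ M) {q : M} (hq : q ∈ e.source) {f : M → N}
    (hf : ContDiffAt ℝ ∞ (f ∘ e.symm) (e q)) : ContMDiffAt (𝓡 d) 𝓘(ℝ, N) ∞ f q := by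
  rw [← contMDiffAt_iff_contDiffAt] at hf
  refine (hf.comp q (contMDiffAt_of_mem_maximalAtlas he hq)).congr_of_eventuallyEq ?_
  filter_upwards [e.open_source.mem_nhds hq] with p hp
  simp [e.left_inv hp]

theorem contMDiffAt_coord {N : Type*} [TopologicalSpace N] {E' H' : Type*} [NormedAddCommGroup E']
    [NormedSpace ℝ E'] [TopologicalSpace H'] {I : ModelWithCorners ℝ E' H'} [ChartedSpace H' N]
    {h : N → EuclideanSpace ℝ (Fin d)} {p : N} (hh : ContMDiffAt I (𝓡 d) ∞ h p) (l : Fin d) :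
    ContMDiffAt I 𝓘(ℝ, ℝ) ∞ (fun y => h y l) p :=
  ((EuclideanSpace.proj l : EuclideanSpace ℝ (Fin d) →L[ℝ] ℝ).contMDiff (n := ∞)).contMDiffAt.comp
    p hh

/-- First-order chain rule for `f = G ∘ h`. -/
theorem pd_comp {e : OpenPartialHomeomorph M (EuclideanSpace ℝ (Fin d))}
    (he : e ∈ IsManifold.maximalAtlas (𝓡 d) ∞ M) {q : M} (hq : q ∈ e.source)
    {h : M → EuclideanSpace ℝ (Fin d)} (hh : ContMDiffAt (𝓡 d) (𝓡 d) ∞ h q)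
    {G : EuclideanSpace ℝ (Fin d) → ℝ} (hG : ContDiffAt ℝ ∞ G (h q)) (i : Fin d) :
    pd e i (G ∘ h) q =
      ∑ l, dirDeriv (EuclideanSpace.single l 1) G (h q) * pd e i (fun p => h p l) q := by
  have h1 := contDiffAt_comp_symm he hq hh
  have := dirDeriv_comp (G := G) (H := h ∘ e.symm) (x := e q)
    (by simpa [e.left_inv hq] using hG.differentiableAt (by simp)) (h1.differentiableAt (by simp))
    (EuclideanSpace.single i 1)
  simp only [Function.comp_apply, e.left_inv hq] at this
  exact this

variable [IsManifold (𝓡 d) ∞ M]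

theorem EllipticVector.squaredField_comp (A : EllipticVector d) {q : M}
    {h : M → EuclideanSpace ℝ (Fin d)} (hh : ContMDiffAt (𝓡 d) (𝓡 d) ∞ h q)
    {G K : EuclideanSpace ℝ (Fin d) → ℝ} (hG : ContDiffAt ℝ ∞ G (h q))
    (hK : ContDiffAt ℝ ∞ K (h q)) :
    A.squaredField q (G ∘ h) (K ∘ h) =
      ∑ l, ∑ m, A.squaredField q (fun p => h p l) (fun p => h p m) *
        dirDeriv (EuclideanSpace.single l 1) G (h q) *
        dirDeriv (EuclideanSpace.single m 1) K (h q) := by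
  have hq := mem_chart_source (EuclideanSpace ℝ (Fin d)) q
  have he := IsManifold.chart_mem_maximalAtlas (I := 𝓡 d) (n := ∞) q
  simp only [squaredField, pd_comp he hq hh hG, pd_comp he hq hh hK, mul_assoc,
    Finset.sum_mul_sum]
  simp only [Finset.mul_sum, Finset.sum_mul]
  rw [sum_four_comm]
  exact Finset.sum_congr rfl fun l _ => Finset.sum_congr rfl fun m _ =>
    Finset.sum_congr rfl fun j _ => Finset.sum_congr rfl fun k _ => by ring

/-- The chain rule `A (G ∘ h) = ∂_l G · A h^l + ½ ∂_l ∂_m G · Γ_A(h^l, h^m)`, that is, Itô's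
formula at the level of generators. -/
theorem EllipticVector.apply_comp (A : EllipticVector d) {q : M}
    {h : M → EuclideanSpace ℝ (Fin d)} (hh : ContMDiffAt (𝓡 d) (𝓡 d) ∞ h q)
    {G : EuclideanSpace ℝ (Fin d) → ℝ} (hG : ContDiffAt ℝ ∞ G (h q)) :
    A.apply q (G ∘ h) =
      (∑ l, A.apply q (fun p => h p l) * dirDeriv (EuclideanSpace.single l 1) G (h q)) +
      1 / 2 * ∑ l, ∑ m, A.squaredField q (fun p => h p l) (fun p => h p m) *
        dirDeriv (EuclideanSpace.single l 1) (dirDeriv (EuclideanSpace.single m 1) G) (h q) := by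
  have hq := mem_chart_source (EuclideanSpace ℝ (Fin d)) q
  have he := IsManifold.chart_mem_maximalAtlas (I := 𝓡 d) (n := ∞) q
  set e := chartAt (EuclideanSpace ℝ (Fin d)) q with hedef
  have h1 := contDiffAt_comp_symm he hq hh
  have hG' : ContDiffAt ℝ ∞ G ((h ∘ e.symm) (e q)) := by
    simpa [e.left_inv hq] using hG
  have h2 : ∀ j k, pd e j (pd e k (G ∘ h)) q =
      (∑ l, dirDeriv (EuclideanSpace.single l 1) G (h q) * pd e j (pd e k fun p => h p l) q) +
      ∑ l, ∑ m, dirDeriv (EuclideanSpace.single l 1)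
          (dirDeriv (EuclideanSpace.single m 1) G) (h q) *
        (pd e j (fun p => h p l) q * pd e k (fun p => h p m) q) := by
    intro j k
    rw [pd_pd hq]
    have := dirDeriv_dirDeriv_comp hG' h1 (EuclideanSpace.single j 1) (EuclideanSpace.single k 1)
    simp only [pd_pd hq]
    simp only [Function.comp_apply, e.left_inv hq] at this
    exact this
  simp only [apply, squaredField, ← hedef, h2, pd_comp he hq hh hG]
  simp only [mul_add, Finset.sum_add_distrib, add_mul, Finset.sum_mul, Finset.mul_sum]
  rw [add_assoc]
  congr 1
  · rw [Finset.sum_comm]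
    exact Finset.sum_congr rfl fun l _ => Finset.sum_congr rfl fun j _ => by ring
  congr 1
  · calc _ = ∑ j, ∑ l, ∑ k, _ := Finset.sum_congr rfl fun j _ => Finset.sum_comm
      _ = ∑ l, ∑ j, ∑ k, _ := Finset.sum_comm
      _ = _ := Finset.sum_congr rfl fun l _ => Finset.sum_congr rfl fun j _ =>
        Finset.sum_congr rfl fun k _ => by ring
  · rw [sum_four_comm]
    exact Finset.sum_congr rfl fun l _ => Finset.sum_congr rfl fun m _ =>
      Finset.sum_congr rfl fun j _ => Finset.sum_congr rfl fun k _ => by ring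

end Chart

/-! ### Test functions on space-time -/

section SpaceTime

variable {d : ℕ} {M : Type*} [TopologicalSpace M] [ChartedSpace (EuclideanSpace ℝ (Fin d)) M]

/-- Smoothness in a chart `e` of `M` of a function depending also on a parameter in the normed
space `W`. -/
theorem contDiffAt_comp_symm_snd {W N : Type*} [NormedAddCommGroup W] [NormedSpace ℝ W]
    [NormedAddCommGroup N] [NormedSpace ℝ N]
    {e : OpenPartialHomeomorph M (EuclideanSpace ℝ (Fin d))}
    (he : e ∈ IsManifold.maximalAtlas (𝓡 d) ∞ M) {w : W} {q : M} (hq : q ∈ e.source)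
    {g : W × M → N} (hg : ContMDiffAt (𝓘(ℝ, W).prod (𝓡 d)) 𝓘(ℝ, N) ∞ g (w, q)) :
    ContDiffAt ℝ ∞ (fun z : W × EuclideanSpace ℝ (Fin d) => g (z.1, e.symm z.2)) (w, e q) := by
  rw [← contMDiffAt_iff_contDiffAt]
  have h1 : ContMDiffAt 𝓘(ℝ, W × EuclideanSpace ℝ (Fin d)) (𝓘(ℝ, W).prod (𝓡 d)) ∞
      (fun z : W × EuclideanSpace ℝ (Fin d) => (z.1, e.symm z.2)) (w, e q) := by
    refine ContMDiffAt.prodMk (contDiff_fst.contMDiff.contMDiffAt) ?_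
    exact ContMDiffAt.comp (g := e.symm) (I' := 𝓘(ℝ, EuclideanSpace ℝ (Fin d))) (w, e q)
      (contMDiffAt_symm_of_mem_maximalAtlas he (e.map_source hq))
      contDiff_snd.contMDiff.contMDiffAt
  refine ContMDiffAt.comp (g := g) (I' := 𝓘(ℝ, W).prod (𝓡 d)) (w, e q) ?_ h1
  simpa [e.left_inv hq] using hg

theorem contMDiffAt_prodMk_chart {W : Type*} [NormedAddCommGroup W] [NormedSpace ℝ W]
    {e : OpenPartialHomeomorph M (EuclideanSpace ℝ (Fin d))}
    (he : e ∈ IsManifold.maximalAtlas (𝓡 d) ∞ M) {w : W} {q : M} (hq : q ∈ e.source) :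
    ContMDiffAt (𝓘(ℝ, W).prod (𝓡 d)) 𝓘(ℝ, W × EuclideanSpace ℝ (Fin d)) ∞
      (fun p : W × M => (p.1, e p.2)) (w, q) :=
  contMDiffAt_fst.prodMk_space
    (ContMDiffAt.comp (g := e) (w, q) (contMDiffAt_of_mem_maximalAtlas he hq) contMDiffAt_snd)

theorem contMDiffAt_slice {W N H' : Type*} [TopologicalSpace N] {E' : Type*}
    [NormedAddCommGroup E'] [NormedSpace ℝ E'] [TopologicalSpace H'] {I : ModelWithCorners ℝ E' H'}
    [ChartedSpace H' N] [NormedAddCommGroup W] [NormedSpace ℝ W] {w : W} {q : M}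
    {g : W × M → N} (hg : ContMDiffAt (𝓘(ℝ, W).prod (𝓡 d)) I ∞ g (w, q)) :
    ContMDiffAt (𝓡 d) I ∞ (fun y => g (w, y)) q :=
  ContMDiffAt.comp (g := g) (I' := 𝓘(ℝ, W).prod (𝓡 d)) q hg (contMDiffAt_const.prodMk contMDiffAt_id)

theorem spaceTimeOp_eq_zero (A : ℝ → M → EllipticVector d) {f : ℝ × M → ℝ} {p : ℝ × M}
    (hp : p ∉ tsupport f) : spaceTimeOp A f p = 0 := by
  have h0 : f =ᶠ[𝓝 p] fun _ => 0 := notMem_tsupport_iff_eventuallyEq.1 hp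
  have h1 : (fun s => f (s, p.2)) =ᶠ[𝓝 p.1] fun _ => 0 :=
    (Continuous.prodMk_left p.2).continuousAt.eventually h0
  have h2 : (fun y => f (p.1, y)) =ᶠ[𝓝 p.2] fun _ => 0 :=
    (Continuous.prodMk_right p.1).continuousAt.eventually h0
  rw [spaceTimeOp, h1.deriv_eq, EllipticVector.apply_congr _ h2, EllipticVector.apply_const]
  simp

variable [IsManifold (𝓡 d) ∞ M]

theorem contMDiff_timeDeriv {f : ℝ × M → ℝ}
    (hf : ContMDiff (𝓘(ℝ, ℝ).prod (𝓡 d)) 𝓘(ℝ, ℝ) ∞ f) :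
    ContMDiff (𝓘(ℝ, ℝ).prod (𝓡 d)) 𝓘(ℝ, ℝ) ∞
      (fun p : ℝ × M => deriv (fun s => f (s, p.2)) p.1) := by
  rintro ⟨t, q⟩
  set e := chartAt (EuclideanSpace ℝ (Fin d)) q
  have hq : q ∈ e.source := mem_chart_source _ q
  have he : e ∈ IsManifold.maximalAtlas (𝓡 d) ∞ M := IsManifold.chart_mem_maximalAtlas q
  have hu : ∀ s, ∀ y ∈ e.source, ContDiffAt ℝ ∞
      (fun z : ℝ × EuclideanSpace ℝ (Fin d) => f (z.1, e.symm z.2)) (s, e y) := fun s y hy =>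
    contDiffAt_comp_symm_snd he hy (hf _)
  refine (ContMDiffAt.comp (t, q) (contMDiffAt_iff_contDiffAt.2
    (contDiffAt_dirDeriv (hu t q hq) (1, 0))) (contMDiffAt_prodMk_chart he hq)
    ).congr_of_eventuallyEq ?_
  have : ∀ᶠ p : ℝ × M in 𝓝 (t, q), p.2 ∈ e.source :=
    continuousAt_snd.eventually (e.open_source.mem_nhds hq)
  filter_upwards [this] with p hp
  have h1 := ((hu p.1 p.2 hp).differentiableAt (by simp)).hasFDerivAt.comp_hasDerivAt p.1
    ((hasDerivAt_id p.1).prodMk (hasDerivAt_const p.1 (e p.2)))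
  have h2 := h1.deriv
  simp only [Function.comp_def, e.left_inv hp, id] at h2
  rw [h2]
  rfl

theorem IsSmoothOperator.continuousOn_spaceTimeOp {t₀ : ℝ} {A : ℝ → M → EllipticVector d}
    (hA : IsSmoothOperator t₀ A) {f : ℝ × M → ℝ}
    (hf : ContMDiff (𝓘(ℝ, ℝ).prod (𝓡 d)) 𝓘(ℝ, ℝ) ∞ f) :
    ContinuousOn (spaceTimeOp A f) (Set.Ici t₀ ×ˢ Set.univ) :=
  (contMDiff_timeDeriv hf).continuous.continuousOn.add (hA f hf).continuousOn

theorem IsSmoothOperator.exists_bound_spaceTimeOp {t₀ : ℝ} {A : ℝ → M → EllipticVector d}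
    (hA : IsSmoothOperator t₀ A) {f : ℝ × M → ℝ}
    (hf : ContMDiff (𝓘(ℝ, ℝ).prod (𝓡 d)) 𝓘(ℝ, ℝ) ∞ f) (hc : HasCompactSupport f) :
    ∃ C, ∀ s, t₀ ≤ s → ∀ x, ‖extendZero (spaceTimeOp A f) s x‖ ≤ C := by
  have hK : IsCompact (tsupport f ∩ Set.Ici t₀ ×ˢ Set.univ) :=
    IsCompact.inter_right hc (isClosed_Ici.prod isClosed_univ)
  obtain ⟨C, hC⟩ := hK.exists_bound_of_continuousOn
    ((hA.continuousOn_spaceTimeOp hf).mono Set.inter_subset_right)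
  refine ⟨max C 0, fun s hs x => ?_⟩
  induction x using OnePoint.rec with
  | infty => simp [extendZero]
  | coe y =>
    by_cases h : (s, y) ∈ tsupport f
    · exact (hC (s, y) ⟨h, hs, trivial⟩).trans (le_max_left _ _)
    · simp [extendZero, spaceTimeOp_eq_zero A h]

end SpaceTime

/-- A function on space-time with compact support, extended by zero to the cemetery point, is
continuous along every continuous path of the one-point compactification. -/
theorem continuousOn_extendZero {M : Type*} [TopologicalSpace M] [T2Space M] {t₀ : ℝ}
    {g : ℝ × M → ℝ} {K : Set (ℝ × M)} (hK : IsCompact K) (h0 : ∀ p ∉ K, g p = 0)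
    (hg : ContinuousOn g (Set.Ici t₀ ×ˢ Set.univ)) {x : ℝ → OnePoint M}
    (hx : ContinuousOn x (Set.Ici t₀)) :
    ContinuousOn (fun s => extendZero g s (x s)) (Set.Ici t₀) := by
  intro s hs
  have key : ∀ z : OnePoint M, Filter.Tendsto (fun p : ℝ × OnePoint M => extendZero g p.1 p.2)
      (𝓝[Set.Ici t₀] s ×ˢ 𝓝 z) (𝓝 (extendZero g s z)) := by
    intro z
    induction z using OnePoint.rec with
    | infty =>
      have hK' : IsCompact (Prod.snd '' K) := hK.image continuous_snd
      have hmem : ((↑) '' (Prod.snd '' K) : Set (OnePoint M))ᶜ ∈ 𝓝 (OnePoint.infty : OnePoint M) :=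
        (OnePoint.isOpen_compl_image_coe.2 ⟨hK'.isClosed, hK'⟩).mem_nhds (by simp)
      refine tendsto_const_nhds.congr' ?_
      filter_upwards [Filter.prod_mem_prod Filter.univ_mem hmem] with p hp
      obtain ⟨r, z⟩ := p
      induction z using OnePoint.rec with
      | infty => rfl
      | coe y =>
        refine (h0 (r, y) fun hy => hp.2 ?_).symm
        exact ⟨y, ⟨_, hy, rfl⟩, rfl⟩
    | coe y =>
      rw [OnePoint.nhds_coe_eq, Filter.prod_map_right, Filter.tendsto_map'_iff]
      have h1 := hg (s, y) ⟨hs, trivial⟩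
      rw [ContinuousWithinAt, nhdsWithin_prod_eq, nhdsWithin_univ] at h1
      exact h1
  exact (key (x s)).comp (Filter.tendsto_id.prodMk (hx s hs))

/-! ### The mean derivatives do not depend on the choice of the generator -/

section Uniqueness

variable {d : ℕ} {M : Type*} [TopologicalSpace M] [T2Space M]
  [ChartedSpace (EuclideanSpace ℝ (Fin d)) M] [IsManifold (𝓡 d) ∞ M]

theorem IsGenerator.continuousOn_path {X : PathProcess M} {q : M} (hX : IsDiffusionFrom d X q)
    {A : ℝ → M → EllipticVector d} (hA : IsGenerator X A) {f : ℝ × M → ℝ}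
    (hf : ContMDiff (𝓘(ℝ, ℝ).prod (𝓡 d)) 𝓘(ℝ, ℝ) ∞ f) (hc : HasCompactSupport f) (w : X.Ω) :
    ContinuousOn (fun s => extendZero (spaceTimeOp A f) s (X.X s w)) (Set.Ici X.t₀) :=
  continuousOn_extendZero hc (fun _ hp => spaceTimeOp_eq_zero A hp)
    (hA.1.continuousOn_spaceTimeOp hf) (hX.continuous w)

theorem tendsto_slope_integral {t₀ : ℝ} {h : ℝ → ℝ} (hh : ContinuousOn h (Set.Ici t₀)) :
    Filter.Tendsto (slope (fun t => ∫ s in t₀..t, h s) t₀) (𝓝[>] t₀) (𝓝 (h t₀)) := by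
  have hd : HasDerivWithinAt (fun t => ∫ s in t₀..t, h s) (h t₀) (Set.Ici t₀) t₀ := by
    refine intervalIntegral.integral_hasDerivWithinAt_right (t := Set.Ioi t₀) (by simp) ?_ ?_
    · exact ⟨Set.Ioi t₀, self_mem_nhdsWithin,
        (hh.mono Set.Ioi_subset_Ici_self).aestronglyMeasurable measurableSet_Ioi⟩
    · exact (hh t₀ Set.self_mem_Ici).mono Set.Ioi_subset_Ici_self
  exact (hasDerivWithinAt_iff_tendsto_slope' (by simp)).1 (hd.mono Set.Ioi_subset_Ici_self)

theorem norm_slope_integral_le {t₀ t C : ℝ} (ht : t₀ < t) {h : ℝ → ℝ}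
    (hC : ∀ s, t₀ ≤ s → ‖h s‖ ≤ C) : ‖slope (fun t => ∫ s in t₀..t, h s) t₀ t‖ ≤ C := by
  have h1 := intervalIntegral.norm_integral_le_of_norm_le_const (a := t₀) (b := t) (f := h) (C := C)
    fun s hs => hC s (by rw [Set.uIoc_of_le ht.le] at hs; exact hs.1.le)
  have hpos : 0 < t - t₀ := sub_pos.2 ht
  rw [slope_def_field, intervalIntegral.integral_same, sub_zero, norm_div, Real.norm_of_nonneg hpos.le,
    div_le_iff₀ hpos]
  rwa [abs_of_pos hpos] at h1

/-- Two generators of the same diffusion agree at its starting point: for a test function `f`, the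
difference of the two martingales is `∫ (B - A) f (s, X(s)) ds`, which has mean zero; dividing by
`t - t₀` and letting `t` tend to `t₀` gives `(A f)(t₀, q) = (B f)(t₀, q)`. -/
theorem IsGenerator.eq_at_start {X : PathProcess M} {q : M} (hX : IsDiffusionFrom d X q)
    {A B : ℝ → M → EllipticVector d} (hA : IsGenerator X A) (hB : IsGenerator X B) :
    A X.t₀ q = B X.t₀ q := by
  refine EllipticVector.eq_of_apply_eq (q := q) fun f₀ hf₀ => ?_
  obtain ⟨ρ⟩ : Nonempty (SmoothBumpFunction (𝓘(ℝ, ℝ).prod (𝓡 d)) ((X.t₀, q) : ℝ × M)) :=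
    inferInstance
  -- a test function with compact support and the germ of `f₀` at `(t₀, q)`
  set f : ℝ × M → ℝ := fun p => ρ p * f₀ p.2 with hfdef
  have hf : ContMDiff (𝓘(ℝ, ℝ).prod (𝓡 d)) 𝓘(ℝ, ℝ) ∞ f :=
    ρ.contMDiff.mul (hf₀.comp contMDiff_snd)
  have hc : HasCompactSupport f := ρ.hasCompactSupport.mul_right
  have hev : (fun y => f (X.t₀, y)) =ᶠ[𝓝 q] f₀ := by
    have h1 : ∀ᶠ y in 𝓝 q, ρ (X.t₀, y) = 1 :=
      (Continuous.prodMk_right X.t₀).continuousAt.eventually ρ.eventuallyEq_one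
    filter_upwards [h1] with y hy
    simp [hfdef, hy]
  suffices h : spaceTimeOp A f (X.t₀, q) = spaceTimeOp B f (X.t₀, q) by
    rw [spaceTimeOp, spaceTimeOp] at h
    have := add_left_cancel h
    rwa [EllipticVector.apply_congr _ hev, EllipticVector.apply_congr _ hev] at this
  set gA := fun w s => extendZero (spaceTimeOp A f) s (X.X s w) with hgA
  set gB := fun w s => extendZero (spaceTimeOp B f) s (X.X s w) with hgB
  obtain ⟨CA, hCA⟩ := hA.1.exists_bound_spaceTimeOp hf hc
  obtain ⟨CB, hCB⟩ := hB.1.exists_bound_spaceTimeOp hf hc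
  have hmart := (hA.2 f hf hc).sub (hB.2 f hf hc)
  have hD : ∀ t, X.t₀ ≤ t → (martingaleProcess X A f - martingaleProcess X B f) t =
      fun w => (∫ s in X.t₀..t, gB w s) - ∫ s in X.t₀..t, gA w s := by
    intro t ht
    funext w
    simp only [Pi.sub_apply, martingaleProcess, max_eq_left ht, hgA, hgB]
    ring
  have hzero : ∀ t, X.t₀ ≤ t →
      ∫ w, ((∫ s in X.t₀..t, gB w s) - ∫ s in X.t₀..t, gA w s) ∂X.P = 0 := by
    intro t ht
    rw [← hD t ht]
    have h1 := hmart.setIntegral_eq ht (MeasurableSet.univ)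
    simp only [Measure.restrict_univ] at h1
    rw [← h1, hD _ le_rfl]
    simp
  -- the mean slope tends to the value at `t₀`, by right-continuity of the paths and boundedness
  have hlim : Filter.Tendsto (fun t => ∫ w, (slope (fun t => ∫ s in X.t₀..t, gB w s) X.t₀ t -
      slope (fun t => ∫ s in X.t₀..t, gA w s) X.t₀ t) ∂X.P) (𝓝[>] X.t₀)
      (𝓝 (∫ w, (gB w X.t₀ - gA w X.t₀) ∂X.P)) := by
    refine tendsto_integral_filter_of_dominated_convergence (fun _ => CB + CA) ?_ ?_
      (integrable_const _) ?_
    · filter_upwards [self_mem_nhdsWithin] with t ht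
      have h1 := (hmart.integrable t).aestronglyMeasurable.const_mul (t - X.t₀)⁻¹
      rw [hD t (le_of_lt ht)] at h1
      refine h1.congr (ae_of_all _ fun w => ?_)
      simp only [slope_def_field, intervalIntegral.integral_same]
      ring
    · filter_upwards [self_mem_nhdsWithin] with t ht
      refine ae_of_all _ fun w => (norm_sub_le _ _).trans (add_le_add ?_ ?_)
      · exact norm_slope_integral_le ht fun s hs => hCB s hs _
      · exact norm_slope_integral_le ht fun s hs => hCA s hs _
    · exact ae_of_all _ fun w => (tendsto_slope_integral (hB.continuousOn_path hX hf hc w)).sub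
        (tendsto_slope_integral (hA.continuousOn_path hX hf hc w))
  -- the same quantity is `0` for every `t > t₀`
  have hlim0 : Filter.Tendsto (fun t => ∫ w, (slope (fun t => ∫ s in X.t₀..t, gB w s) X.t₀ t -
      slope (fun t => ∫ s in X.t₀..t, gA w s) X.t₀ t) ∂X.P) (𝓝[>] X.t₀) (𝓝 0) := by
    refine tendsto_const_nhds.congr' ?_
    filter_upwards [self_mem_nhdsWithin] with t ht
    have h1 := congrArg (fun r => (t - X.t₀)⁻¹ * r) (hzero t (le_of_lt ht))
    simp only [mul_zero] at h1
    rw [← h1, ← integral_const_mul]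
    refine integral_congr_ae (ae_of_all _ fun w => ?_)
    simp only [slope_def_field, intervalIntegral.integral_same]
    ring
  have hval : ∫ w, (gB w X.t₀ - gA w X.t₀) ∂X.P =
      spaceTimeOp B f (X.t₀, q) - spaceTimeOp A f (X.t₀, q) := by
    have : (fun w => gB w X.t₀ - gA w X.t₀) =ᵐ[X.P]
        fun _ => spaceTimeOp B f (X.t₀, q) - spaceTimeOp A f (X.t₀, q) := by
      filter_upwards [hX.start] with w hw
      simp only [hgA, hgB, hw]
      rfl
    rw [integral_congr_ae this]
    simp
  rw [hval] at hlim
  have := tendsto_nhds_unique hlim hlim0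
  linarith

/-- The mean derivatives of a diffusion can be computed from any of its generators. -/
theorem Diffusion.meanDeriv_eq (X : Diffusion d M) {A : ℝ → M → EllipticVector d}
    (hA : IsGenerator X.proc A) : X.meanDeriv = A X.proc.t₀ X.q :=
  IsGenerator.eq_at_start X.isDiffusionFrom X.isDiffusionFrom.exists_generator.choose_spec hA

end Uniqueness

/-! ### Transport of second-order operators by bundle diffeomorphisms -/

section Transport

variable {d : ℕ} {M : Type*} [TopologicalSpace M] [ChartedSpace (EuclideanSpace ℝ (Fin d)) M]

/-- The diffeomorphism `F` of `ℝ × M`, with inverse `Finv`, covers the increasing diffeomorphism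
`F₀` of `ℝ`. -/
structure IsBundleDiffeo (F Finv : ℝ × M → ℝ × M) (F₀ : ℝ ≃o ℝ) : Prop where
  smooth : ContMDiff (𝓘(ℝ, ℝ).prod (𝓡 d)) (𝓘(ℝ, ℝ).prod (𝓡 d)) ∞ F
  smooth_inv : ContMDiff (𝓘(ℝ, ℝ).prod (𝓡 d)) (𝓘(ℝ, ℝ).prod (𝓡 d)) ∞ Finv
  left_inv : ∀ p, Finv (F p) = p
  right_inv : ∀ p, F (Finv p) = p
  smooth_time : ContDiff ℝ ∞ F₀
  smooth_time_symm : ContDiff ℝ ∞ F₀.symm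
  fst_eq : ∀ p, (F p).1 = F₀ p.1

theorem deriv_orderIso_pos {F₀ : ℝ ≃o ℝ} (h : ContDiff ℝ ∞ F₀) (h' : ContDiff ℝ ∞ F₀.symm) (t : ℝ) :
    0 < deriv F₀ t := by
  have h1 : HasDerivAt F₀ (deriv F₀ t) t := (h.differentiable (by simp) t).hasDerivAt
  have h2 : HasDerivAt F₀.symm (deriv F₀.symm (F₀ t)) (F₀ t) :=
    (h'.differentiable (by simp) _).hasDerivAt
  have h3 := (h2.comp t h1).deriv
  have h4 : (F₀.symm ∘ F₀ : ℝ → ℝ) = id := by funext s; simp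
  rw [h4, deriv_id] at h3
  refine lt_of_le_of_ne F₀.monotone.deriv_nonneg fun h0 => ?_
  rw [← h0] at h3
  simp at h3

/-- The second-order vector `(F₀')⁻¹ ((∂_t + A)(· ∘ F) - F₀' ∂_s)` at `F(t, x)`, for `A` at `(t, x)`.
Its coefficients in the preferred chart `(φ^i)` at the image point are obtained by applying it to
the coordinate functions.  The identification with this operator needs `F₀' ≠ 0`; where `F₀' = 0`
both coefficients vanish by the convention `0⁻¹ = 0`. -/
noncomputable def EllipticVector.transport (A : EllipticVector d) (t : ℝ) (x : M)
    (F : ℝ × M → ℝ × M) (F₀ : ℝ ≃o ℝ) : EllipticVector d where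
  b i := (deriv F₀ t)⁻¹ *
    (deriv (fun s => chartAt (EuclideanSpace ℝ (Fin d)) (F (t, x)).2 (F (s, x)).2 i) t +
      A.apply x fun y => chartAt (EuclideanSpace ℝ (Fin d)) (F (t, x)).2 (F (t, y)).2 i)
  a := Matrix.of fun j k => (deriv F₀ t)⁻¹ * A.squaredField x
    (fun y => chartAt (EuclideanSpace ℝ (Fin d)) (F (t, x)).2 (F (t, y)).2 j)
    fun y => chartAt (EuclideanSpace ℝ (Fin d)) (F (t, x)).2 (F (t, y)).2 k
  posSemidef := by
    -- up to the factor `(F₀')⁻¹ ≥ 0` this is `J a Jᵀ`, with `J` the Jacobian matrix of `F (t, ·)`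
    set J : Matrix (Fin d) (Fin d) ℝ := Matrix.of fun j l =>
      pd (chartAt (EuclideanSpace ℝ (Fin d)) x) l
        (fun y => chartAt (EuclideanSpace ℝ (Fin d)) (F (t, x)).2 (F (t, y)).2 j) x
    have hc : 0 ≤ (deriv F₀ t)⁻¹ := inv_nonneg.2 F₀.monotone.deriv_nonneg
    convert! (A.posSemidef.mul_mul_conjTranspose_same J).smul hc using 1
    ext j k
    simp only [Matrix.of_apply, Matrix.smul_apply, smul_eq_mul, squaredField, Matrix.mul_apply,
      Matrix.conjTranspose_apply, star_trivial, Finset.sum_mul, J]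
    congr 1
    rw [Finset.sum_comm]
    exact Finset.sum_congr rfl fun l _ => Finset.sum_congr rfl fun m _ => by ring

variable {F Finv : ℝ × M → ℝ × M} {F₀ : ℝ ≃o ℝ}

theorem IsBundleDiffeo.contMDiffAt_chart (hF : IsBundleDiffeo (d := d) F Finv F₀)
    {e : OpenPartialHomeomorph M (EuclideanSpace ℝ (Fin d))}
    (he : e ∈ IsManifold.maximalAtlas (𝓡 d) ∞ M) {p : ℝ × M} (hp : (F p).2 ∈ e.source) :
    ContMDiffAt (𝓘(ℝ, ℝ).prod (𝓡 d)) (𝓡 d) ∞ (fun p => e (F p).2) p :=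
  ContMDiffAt.comp (g := e) p (contMDiffAt_of_mem_maximalAtlas he hp)
    (contMDiff_snd.contMDiffAt.comp p hF.smooth.contMDiffAt)

/-- The image of a time-dependent second-order operator under `F`. -/
noncomputable def pushforwardOp (A : ℝ → M → EllipticVector d) (F Finv : ℝ × M → ℝ × M)
    (F₀ : ℝ ≃o ℝ) (s : ℝ) (y : M) : EllipticVector d :=
  (A (Finv (s, y)).1 (Finv (s, y)).2).transport (Finv (s, y)).1 (Finv (s, y)).2 F F₀

theorem IsBundleDiffeo.pushforwardOp_apply_eq (hF : IsBundleDiffeo (d := d) F Finv F₀)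
    (A : ℝ → M → EllipticVector d) (p : ℝ × M) :
    pushforwardOp A F Finv F₀ (F p).1 (F p).2 = (A p.1 p.2).transport p.1 p.2 F F₀ := by
  rw [pushforwardOp, show ((F p).1, (F p).2) = F p from rfl, hF.left_inv]

variable [IsManifold (𝓡 d) ∞ M]

/-- The transported operator satisfies `F₀' (∂_s + T)g ∘ F = (∂_t + A)(g ∘ F)`. -/
theorem EllipticVector.transport_apply (hF : IsBundleDiffeo (d := d) F Finv F₀)
    (A : EllipticVector d) {t : ℝ} {x : M} {g : ℝ × M → ℝ}
    (hg : ContMDiffAt (𝓘(ℝ, ℝ).prod (𝓡 d)) 𝓘(ℝ, ℝ) ∞ g (F (t, x))) :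
    deriv F₀ t * (deriv (fun s => g (s, (F (t, x)).2)) (F (t, x)).1 +
      (A.transport t x F F₀).apply (F (t, x)).2 fun y => g ((F (t, x)).1, y)) =
    deriv (fun s => g (F (s, x))) t + A.apply x fun y => g (F (t, y)) := by
  have hpos := deriv_orderIso_pos hF.smooth_time hF.smooth_time_symm t
  set y₀ := (F (t, x)).2 with hy₀
  have hfst : ∀ s y, (F (s, y)).1 = F₀ s := fun s y => hF.fst_eq _
  rw [show F (t, x) = (F₀ t, y₀) from Prod.ext (hfst _ _) rfl] at hg
  rw [hfst]
  set φ := chartAt (EuclideanSpace ℝ (Fin d)) y₀ with hφ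
  have hy : y₀ ∈ φ.source := mem_chart_source _ _
  have he : φ ∈ IsManifold.maximalAtlas (𝓡 d) ∞ M := IsManifold.chart_mem_maximalAtlas _
  -- near `(t, x)`, `g ∘ F = u (F₀, H)` with `u` and `H` the coordinate expressions of `g` and `F`
  set H : ℝ × M → EuclideanSpace ℝ (Fin d) := fun p => φ (F p).2 with hH
  have hHs : ContMDiffAt (𝓘(ℝ, ℝ).prod (𝓡 d)) (𝓡 d) ∞ H (t, x) := hF.contMDiffAt_chart he hy
  set u : ℝ × EuclideanSpace ℝ (Fin d) → ℝ := fun z => g (z.1, φ.symm z.2) with hu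
  have hus : ContDiffAt ℝ ∞ u (F₀ t, φ y₀) := contDiffAt_comp_symm_snd he hy hg
  set G : EuclideanSpace ℝ (Fin d) → ℝ := fun z => u (F₀ t, z) with hG
  have hGs : ContDiffAt ℝ ∞ G (φ y₀) :=
    hus.comp (φ y₀) (contDiffAt_const.prodMk contDiffAt_id)
  have hud := (hus.differentiableAt (by simp)).hasFDerivAt
  have hGd : ∀ v, dirDeriv v G (φ y₀) = fderiv ℝ u (F₀ t, φ y₀) (0, v) := by
    intro v
    have := (hud.comp (φ y₀) (hasFDerivAt_prodMk_right (F₀ t) (φ y₀))).fderiv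
    simp only [Function.comp_def] at this
    rw [dirDeriv, hG, this]
    simp
  -- the space derivatives
  have hspace : A.apply x (fun y => g (F (t, y))) = A.apply x (G ∘ fun y => H (t, y)) := by
    refine A.apply_congr ?_
    have hcont : ContinuousAt (fun y => (F (t, y)).2) x :=
      (continuous_snd.comp (hF.smooth.continuous.comp (Continuous.prodMk_right t))).continuousAt
    filter_upwards [hcont.eventually (φ.open_source.mem_nhds hy)] with y hys
    simp only [Function.comp_apply, hG, hu, hH, φ.left_inv hys]
    rw [← hfst t y]
  have hsl : ContMDiffAt (𝓡 d) (𝓡 d) ∞ (fun y => H (t, y)) x := contMDiffAt_slice hHs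
  have hcomp := A.apply_comp hsl (G := G) hGs
  -- the time derivative
  have hη : DifferentiableAt ℝ (fun s => H (s, x)) t := by
    have : ContMDiffAt 𝓘(ℝ, ℝ) (𝓡 d) ∞ (fun s => H (s, x)) t :=
      ContMDiffAt.comp (g := H) (I' := 𝓘(ℝ, ℝ).prod (𝓡 d)) t hHs
        (contMDiffAt_id.prodMk contMDiffAt_const)
    exact (contMDiffAt_iff_contDiffAt.1 this).differentiableAt (by simp)
  have hηl : ∀ l, deriv (fun s => H (s, x) l) t = (deriv (fun s => H (s, x)) t) l := fun l =>
    ((EuclideanSpace.proj l : EuclideanSpace ℝ (Fin d) →L[ℝ] ℝ).hasFDerivAt.comp_hasDerivAt t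
      hη.hasDerivAt).deriv
  have htime : deriv (fun s => g (F (s, x))) t =
      deriv F₀ t * deriv (fun s => g (s, y₀)) (F₀ t) +
        ∑ l, deriv (fun s => H (s, x) l) t * dirDeriv (EuclideanSpace.single l 1) G (φ y₀) := by
    have hev : (fun s => g (F (s, x))) =ᶠ[𝓝 t] fun s => u (F₀ s, H (s, x)) := by
      have hcont : ContinuousAt (fun s => (F (s, x)).2) t :=
        (continuous_snd.comp (hF.smooth.continuous.comp (Continuous.prodMk_left x))).continuousAt
      filter_upwards [hcont.eventually (φ.open_source.mem_nhds hy)] with s hs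
      simp only [hu, hH, φ.left_inv hs]
      rw [← hfst s x]
    have h1 := hud.comp_hasDerivAt_of_eq t
      (((hF.smooth_time.differentiable (by simp) t).hasDerivAt).prodMk hη.hasDerivAt) rfl
    rw [hev.deriv_eq, show deriv (fun s => u (F₀ s, H (s, x))) t = _ from h1.deriv]
    have h2 := (hud.comp_hasDerivAt (F₀ t)
      ((hasDerivAt_id (F₀ t)).prodMk (hasDerivAt_const (F₀ t) (φ y₀)))).deriv
    simp only [Function.comp_def, hu, φ.left_inv hy, id] at h2
    rw [h2]
    simp only [hGd, hηl]
    have hsplit : (deriv F₀ t, deriv (fun s => H (s, x)) t) =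
        deriv F₀ t • ((1 : ℝ), (0 : EuclideanSpace ℝ (Fin d))) +
          ∑ l, (deriv (fun s => H (s, x)) t) l •
            ((0 : ℝ), (EuclideanSpace.single l 1 : EuclideanSpace ℝ (Fin d))) := by
      have := sum_smul_single (deriv (fun s => H (s, x)) t)
      ext1
      · simp [Prod.fst_sum]
      · simpa [Prod.snd_sum] using this
    rw [hsplit, map_add, map_sum]
    simp only [map_smul, smul_eq_mul]
    rfl
  have hop : (A.transport t x F F₀).apply y₀ (fun y => g (F₀ t, y)) =
      (∑ l, (deriv F₀ t)⁻¹ * (deriv (fun s => H (s, x) l) t + A.apply x fun y => H (t, y) l) *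
        dirDeriv (EuclideanSpace.single l 1) G (φ y₀)) +
      1 / 2 * ∑ l, ∑ m, (deriv F₀ t)⁻¹ *
        A.squaredField x (fun y => H (t, y) l) (fun y => H (t, y) m) *
        dirDeriv (EuclideanSpace.single l 1) (dirDeriv (EuclideanSpace.single m 1) G) (φ y₀) := by
    rw [EllipticVector.apply, ← hφ]
    simp only [pd_pd hy]
    rfl
  rw [hop, hspace, hcomp, htime]
  simp only [mul_add, add_mul, Finset.sum_add_distrib, Finset.mul_sum]
  field_simp
  ring

/-- `F₀' Γ_T(f, g) ∘ F = Γ_A(f ∘ F, g ∘ F)` for the transported operator `T`. -/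
theorem EllipticVector.transport_squaredField (hF : IsBundleDiffeo (d := d) F Finv F₀)
    (A : EllipticVector d) {t : ℝ} {x : M} {f g : M → ℝ}
    (hf : ContMDiffAt (𝓡 d) 𝓘(ℝ, ℝ) ∞ f (F (t, x)).2)
    (hg : ContMDiffAt (𝓡 d) 𝓘(ℝ, ℝ) ∞ g (F (t, x)).2) :
    deriv F₀ t * (A.transport t x F F₀).squaredField (F (t, x)).2 f g =
      A.squaredField x (fun y => f (F (t, y)).2) fun y => g (F (t, y)).2 := by
  have hpos := deriv_orderIso_pos hF.smooth_time hF.smooth_time_symm t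
  set y₀ := (F (t, x)).2 with hy₀
  set φ := chartAt (EuclideanSpace ℝ (Fin d)) y₀ with hφ
  have hy : y₀ ∈ φ.source := mem_chart_source _ _
  have he : φ ∈ IsManifold.maximalAtlas (𝓡 d) ∞ M := IsManifold.chart_mem_maximalAtlas _
  have hHs : ContMDiffAt (𝓡 d) (𝓡 d) ∞ (fun y => φ (F (t, y)).2) x :=
    contMDiffAt_slice (g := fun p => φ (F p).2) (hF.contMDiffAt_chart he hy)
  have hcont : ContinuousAt (fun y => (F (t, y)).2) x :=
    (continuous_snd.comp (hF.smooth.continuous.comp (Continuous.prodMk_right t))).continuousAt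
  have hev : ∀ f : M → ℝ, (fun y => f (F (t, y)).2) =ᶠ[𝓝 x]
      (f ∘ φ.symm) ∘ fun y => φ (F (t, y)).2 := by
    intro f
    filter_upwards [hcont.eventually (φ.open_source.mem_nhds hy)] with y hys
    simp only [Function.comp_apply, φ.left_inv hys]
  rw [A.squaredField_congr (hev f) (hev g), A.squaredField_comp hHs
    (contDiffAt_comp_symm he hy hf) (contDiffAt_comp_symm he hy hg), EllipticVector.squaredField,
    ← hφ]
  simp only [Finset.mul_sum]
  refine Finset.sum_congr rfl fun j _ => Finset.sum_congr rfl fun k _ => ?_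
  have : (A.transport t x F F₀).a j k = (deriv F₀ t)⁻¹ * A.squaredField x
      (fun y => φ (F (t, y)).2 j) fun y => φ (F (t, y)).2 k := rfl
  rw [this]
  have h1 : ∀ (l : Fin d) (f : M → ℝ), pd φ l f y₀ =
    dirDeriv (EuclideanSpace.single l 1) (f ∘ φ.symm) (φ y₀) := fun _ _ => rfl
  rw [h1, h1]
  field_simp
  rfl

theorem IsBundleDiffeo.spaceTimeOp_pushforwardOp (hF : IsBundleDiffeo (d := d) F Finv F₀)
    (A : ℝ → M → EllipticVector d) {g : ℝ × M → ℝ}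
    (hg : ContMDiff (𝓘(ℝ, ℝ).prod (𝓡 d)) 𝓘(ℝ, ℝ) ∞ g) (p : ℝ × M) :
    deriv F₀ p.1 * spaceTimeOp (pushforwardOp A F Finv F₀) g (F p) =
      spaceTimeOp A (g ∘ F) p := by
  rw [spaceTimeOp, hF.pushforwardOp_apply_eq]
  exact EllipticVector.transport_apply hF (A p.1 p.2) hg.contMDiffAt

/-- Smoothness of the transported operator, read off from
`T f = (F₀')⁻¹ (∂_t + A)(f ∘ F) ∘ F⁻¹ - ∂_s f`. -/
theorem IsBundleDiffeo.isSmoothOperator (hF : IsBundleDiffeo (d := d) F Finv F₀) {t₀ : ℝ}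
    {A : ℝ → M → EllipticVector d} (hA : IsSmoothOperator t₀ A) :
    IsSmoothOperator (F₀ t₀) (pushforwardOp A F Finv F₀) := by
  intro f hf
  have hfst : ∀ p, (Finv p).1 = F₀.symm p.1 := fun p => by
    rw [F₀.eq_symm_apply, ← hF.fst_eq, hF.right_inv]
  have hfF : ContMDiff (𝓘(ℝ, ℝ).prod (𝓡 d)) 𝓘(ℝ, ℝ) ∞ (f ∘ F) := hf.comp hF.smooth
  have h1 : ContMDiffOn (𝓘(ℝ, ℝ).prod (𝓡 d)) 𝓘(ℝ, ℝ) ∞ (spaceTimeOp A (f ∘ F))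
      (Set.Ici t₀ ×ˢ Set.univ) := (contMDiff_timeDeriv hfF).contMDiffOn.add (hA _ hfF)
  have h2 : ContMDiffOn (𝓘(ℝ, ℝ).prod (𝓡 d)) 𝓘(ℝ, ℝ) ∞ (spaceTimeOp A (f ∘ F) ∘ Finv)
      (Set.Ici (F₀ t₀) ×ˢ Set.univ) := by
    refine h1.comp hF.smooth_inv.contMDiffOn fun p hp => ⟨?_, trivial⟩
    change t₀ ≤ (Finv p).1
    rw [hfst, F₀.le_symm_apply]
    exact hp.1
  have h3 : ContMDiff (𝓘(ℝ, ℝ).prod (𝓡 d)) 𝓘(ℝ, ℝ) ∞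
      (fun p : ℝ × M => (deriv F₀ (F₀.symm p.1))⁻¹) := by
    have h4 : ContDiff ℝ ∞ fun s => (deriv F₀ (F₀.symm s))⁻¹ :=
      ((contDiff_infty_iff_deriv.1 hF.smooth_time).2.comp hF.smooth_time_symm).inv fun s =>
        (deriv_orderIso_pos hF.smooth_time hF.smooth_time_symm _).ne'
    exact h4.contMDiff.comp contMDiff_fst
  refine ((h3.contMDiffOn.mul h2).sub (contMDiff_timeDeriv hf).contMDiffOn).congr fun p _ => ?_
  have hop := hF.spaceTimeOp_pushforwardOp A hf (Finv p)
  rw [hF.right_inv, hfst] at hop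
  have hpos := deriv_orderIso_pos hF.smooth_time hF.smooth_time_symm (F₀.symm p.1)
  simp only [Pi.mul_apply, Function.comp_apply, ← hop]
  rw [inv_mul_cancel_left₀ hpos.ne', spaceTimeOp]
  simp

end Transport

/-! ### The pushforward of a diffusion -/

section Pushforward

variable {d : ℕ} {M : Type*} [TopologicalSpace M] [ChartedSpace (EuclideanSpace ℝ (Fin d)) M]
  {F Finv : ℝ × M → ℝ × M} {F₀ : ℝ ≃o ℝ}

theorem IsBundleDiffeo.extendZero_map (hF : IsBundleDiffeo (d := d) F Finv F₀) (g : ℝ × M → ℝ)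
    (s : ℝ) (z : OnePoint M) :
    extendZero g s (z.map fun y => (F (F₀.symm s, y)).2) = extendZero (g ∘ F) (F₀.symm s) z := by
  induction z using OnePoint.rec with
  | infty => rfl
  | coe y =>
    have : F (F₀.symm s, y) = (s, (F (F₀.symm s, y)).2) := Prod.ext (by simp [hF.fst_eq]) rfl
    change g (s, (F (F₀.symm s, y)).2) = g (F (F₀.symm s, y))
    rw [← this]

/-- The fibrewise homeomorphisms `F (t, ·)` extend to the one-point compactification, jointly
continuously in `t`: for `K ⊆ M` compact and `t` in a compact interval, the preimages of `K` stay
in a compact set, since `F` is a homeomorphism of `ℝ × M`. -/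
theorem IsBundleDiffeo.continuous_onePoint_map [T2Space M]
    (hF : IsBundleDiffeo (d := d) F Finv F₀) :
    Continuous fun p : ℝ × OnePoint M => p.2.map fun y => (F (p.1, y)).2 := by
  rw [continuous_iff_continuousAt]
  rintro ⟨t, z⟩
  induction z using OnePoint.rec with
  | infty =>
    rw [ContinuousAt]
    change Filter.Tendsto _ _ (𝓝 (OnePoint.infty : OnePoint M))
    rw [OnePoint.hasBasis_nhds_infty.tendsto_right_iff]
    rintro K ⟨-, hK⟩
    set K' : Set M := Prod.snd '' (Finv '' (Set.Icc (F₀ (t - 1)) (F₀ (t + 1)) ×ˢ K)) with hK'def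
    have hK' : IsCompact K' :=
      ((isCompact_Icc.prod hK).image hF.smooth_inv.continuous).image continuous_snd
    have h1 : ((↑) '' K' : Set (OnePoint M))ᶜ ∈ 𝓝 (OnePoint.infty : OnePoint M) :=
      (OnePoint.isOpen_compl_image_coe.2 ⟨hK'.isClosed, hK'⟩).mem_nhds (by simp)
    have h2 : Set.Icc (t - 1) (t + 1) ∈ 𝓝 t := Icc_mem_nhds (by linarith) (by linarith)
    rw [nhds_prod_eq]
    filter_upwards [Filter.prod_mem_prod h2 h1] with p hp
    obtain ⟨s, z⟩ := p
    induction z using OnePoint.rec with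
    | infty => exact Or.inr rfl
    | coe y =>
      refine Or.inl ⟨_, fun hy => hp.2 ⟨y, ⟨(s, y), ⟨F (s, y), ⟨?_, hy⟩, hF.left_inv _⟩, rfl⟩, rfl⟩,
        rfl⟩
      rw [hF.fst_eq]
      exact ⟨F₀.monotone hp.1.1, F₀.monotone hp.1.2⟩
  | coe y =>
    rw [ContinuousAt, nhds_prod_eq, OnePoint.nhds_coe_eq, Filter.prod_map_right,
      Filter.tendsto_map'_iff, ← nhds_prod_eq]
    have : Continuous fun p : ℝ × M => (((F p).2 : M) : OnePoint M) :=
      OnePoint.continuous_coe.comp (continuous_snd.comp hF.smooth.continuous)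
    exact this.tendsto (t, y)

variable [IsManifold (𝓡 d) ∞ M]

/-- `M^{f, F·X}(s) = M^{f ∘ F, X}(F₀⁻¹(s))`, by the change of variables `s = F₀(r)` in the time
integral. -/
theorem IsBundleDiffeo.martingaleProcess_pushforward (hF : IsBundleDiffeo (d := d) F Finv F₀)
    (X : PathProcess M) (A : ℝ → M → EllipticVector d) {f : ℝ × M → ℝ}
    (hf : ContMDiff (𝓘(ℝ, ℝ).prod (𝓡 d)) 𝓘(ℝ, ℝ) ∞ f) (s : ℝ) :
    martingaleProcess (X.pushforward F F₀) (pushforwardOp A F Finv F₀) f s =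
      martingaleProcess X A (f ∘ F) (F₀.symm s) := by
  funext w
  -- the freezing at the initial time is compatible with the change of clock
  have hmax : max s (F₀ X.t₀) = F₀ (max (F₀.symm s) X.t₀) := by
    rw [F₀.monotone.map_max, F₀.apply_symm_apply]
  have hval : ∀ (g : ℝ × M → ℝ) (u : ℝ), extendZero g u ((X.pushforward F F₀).X u w) =
      extendZero (g ∘ F) (F₀.symm u) (X.X (F₀.symm u) w) := fun g u => hF.extendZero_map g u _
  change extendZero f (max s (F₀ X.t₀)) ((X.pushforward F F₀).X (max s (F₀ X.t₀)) w) -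
    extendZero f (F₀ X.t₀) ((X.pushforward F F₀).X (F₀ X.t₀) w) -
    (∫ u in F₀ X.t₀..max s (F₀ X.t₀), extendZero (spaceTimeOp (pushforwardOp A F Finv F₀) f) u
      ((X.pushforward F F₀).X u w)) = _
  simp only [hval, martingaleProcess]
  rw [hmax]
  simp only [F₀.symm_apply_apply]
  congr 1
  have hle : X.t₀ ≤ max (F₀.symm s) X.t₀ := le_max_right _ _
  rw [intervalIntegral.integral_of_le (F₀.monotone hle), intervalIntegral.integral_of_le hle,
    ← F₀.image_Ioc, integral_image_eq_integral_deriv_smul_of_monotoneOn measurableSet_Ioc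
      (fun r _ => ((hF.smooth_time.differentiable (by simp) r).hasDerivAt).hasDerivWithinAt)
      (F₀.monotone.monotoneOn _)]
  refine setIntegral_congr_fun measurableSet_Ioc fun r _ => ?_
  simp only [F₀.symm_apply_apply, smul_eq_mul]
  generalize X.X r w = z
  induction z using OnePoint.rec with
  | infty => exact mul_zero _
  | coe y => exact hF.spaceTimeOp_pushforwardOp A hf (r, y)

theorem IsBundleDiffeo.isGenerator_pushforward (hF : IsBundleDiffeo (d := d) F Finv F₀)
    {X : PathProcess M} {A : ℝ → M → EllipticVector d} (hA : IsGenerator X A) :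
    IsGenerator (X.pushforward F F₀) (pushforwardOp A F Finv F₀) := by
  refine ⟨hF.isSmoothOperator hA.1, fun f hf hc => ?_⟩
  have hcF : HasCompactSupport (f ∘ F) := by
    let Φ : ℝ × M ≃ₜ ℝ × M :=
      { toFun := F
        invFun := Finv
        left_inv := hF.left_inv
        right_inv := hF.right_inv
        continuous_toFun := hF.smooth.continuous
        continuous_invFun := hF.smooth_inv.continuous }
    exact hc.comp_homeomorph Φ
  have hm := hA.2 (f ∘ F) (hf.comp hF.smooth) hcF
  refine ⟨fun s => ?_, fun s s' hs => ?_⟩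
  · rw [hF.martingaleProcess_pushforward X A hf s]
    exact hm.1 (F₀.symm s)
  · rw [hF.martingaleProcess_pushforward X A hf s, hF.martingaleProcess_pushforward X A hf s']
    exact hm.2 _ _ (F₀.symm.monotone hs)

theorem IsBundleDiffeo.isDiffusionFrom_pushforward [T2Space M]
    (hF : IsBundleDiffeo (d := d) F Finv F₀) {X : PathProcess M} {q : M}
    (hX : IsDiffusionFrom d X q) :
    IsDiffusionFrom d (X.pushforward F F₀) (F (X.t₀, q)).2 where
  rightCont := by
    refine ⟨fun s => ?_⟩
    have h1 : X.𝓟 (F₀.symm s) = ⨅ i > F₀.symm s, X.𝓟 i := by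
      rw [← Filtration.rightCont_eq, hX.rightCont.eq]
    rw [Filtration.rightCont_eq]
    change _ ≤ X.𝓟 (F₀.symm s)
    rw [h1]
    refine le_iInf₂ fun i hi => iInf₂_le_of_le (F₀ i) ?_ ?_
    · exact (F₀.symm_apply_lt).1 hi
    · change X.𝓟 (F₀.symm (F₀ i)) ≤ _
      rw [F₀.symm_apply_apply]
  complete t s hs := hX.complete (F₀.symm t) s hs
  stoppingTime := by
    intro s
    have : {w | (X.pushforward F F₀).τ w ≤ s} = {w | X.τ w ≤ (F₀.symm s : ℝ)} := by
      ext w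
      change (X.τ w).map F₀ ≤ s ↔ X.τ w ≤ (F₀.symm s : ℝ)
      induction X.τ w using WithTop.recTopCoe with
      | top => simp
      | coe r => simp [F₀.le_symm_apply]
    rw [this]
    exact hX.stoppingTime (F₀.symm s)
  lifetime_pos w := by
    have := hX.lifetime_pos w
    change ((F₀ X.t₀ : ℝ) : WithTop ℝ) < (X.τ w).map F₀
    revert this
    induction X.τ w using WithTop.recTopCoe with
    | top => simp
    | coe r => simp
  adapted s hs := by
    have h1 := hX.adapted (F₀.symm s) ((F₀.le_symm_apply).2 hs)
    have h2 : Continuous fun z : OnePoint M => z.map fun y => (F (F₀.symm s, y)).2 :=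
      hF.continuous_onePoint_map.comp (Continuous.prodMk_right (F₀.symm s))
    exact (h2.borel_measurable).comp h1
  continuous w := by
    have h1 : ContinuousOn (fun s => X.X (F₀.symm s) w) (Set.Ici (F₀ X.t₀)) :=
      (hX.continuous w).comp hF.smooth_time_symm.continuous.continuousOn fun s hs =>
        (F₀.le_symm_apply).2 hs
    exact hF.continuous_onePoint_map.comp_continuousOn
      (hF.smooth_time_symm.continuous.continuousOn.prodMk h1)
  alive_iff w s hs := by
    have h1 := hX.alive_iff w (F₀.symm s) ((F₀.le_symm_apply).2 hs)
    change (X.X (F₀.symm s) w).map _ ≠ OnePoint.infty ↔ (s : WithTop ℝ) < (X.τ w).map F₀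
    have h2 : ∀ (z : OnePoint M) (k : M → M), z.map k ≠ OnePoint.infty ↔ z ≠ OnePoint.infty := by
      intro z k
      induction z using OnePoint.rec <;> simp
    rw [h2, h1]
    induction X.τ w using WithTop.recTopCoe with
    | top => simp
    | coe r => simp [F₀.symm_apply_lt]
  start := by
    filter_upwards [hX.start] with w hw
    change (X.X (F₀.symm (F₀ X.t₀)) w).map (fun y => (F (F₀.symm (F₀ X.t₀), y)).2) = _
    simp only [F₀.symm_apply_apply]
    rw [hw]
    rfl
  exists_generator := by
    obtain ⟨A, hA⟩ := hX.exists_generator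
    exact ⟨_, hF.isGenerator_pushforward hA⟩

/-- The diffusion `F · X`. -/
def IsBundleDiffeo.pushforward [T2Space M] (hF : IsBundleDiffeo (d := d) F Finv F₀)
    (X : Diffusion d M) : Diffusion d M :=
  ⟨X.proc.pushforward F F₀, (F (X.proc.t₀, X.q)).2,
    hF.isDiffusionFrom_pushforward X.isDiffusionFrom⟩

/-- The mean derivatives of `F · X` depend only on those of `X`. -/
theorem IsBundleDiffeo.meanDeriv_pushforward [T2Space M]
    (hF : IsBundleDiffeo (d := d) F Finv F₀) (X : Diffusion d M) :
    (hF.pushforward X).meanDeriv = X.meanDeriv.transport X.proc.t₀ X.q F F₀ := by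
  obtain ⟨A, hA⟩ := X.isDiffusionFrom.exists_generator
  rw [X.meanDeriv_eq hA, (hF.pushforward X).meanDeriv_eq (hF.isGenerator_pushforward hA)]
  rw [← hF.pushforwardOp_apply_eq A (X.proc.t₀, X.q), hF.fst_eq]
  rfl

end Pushforward

/-! ### Differentiation with respect to a parameter -/

section Parameter

/-- Equality of mixed derivatives, for a function of two real variables. -/
theorem hasDerivAt_deriv_comm {k : ℝ × ℝ → ℝ} {a t : ℝ}
    (hk : ∀ᶠ p in 𝓝 (a, t), ContDiffAt ℝ ∞ k p) :
    HasDerivAt (fun ε => deriv (fun s => k (ε, s)) t)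
      (deriv (fun s => deriv (fun ε => k (ε, s)) a) t) a := by
  have h1 : ∀ p : ℝ × ℝ, ContDiffAt ℝ ∞ k p →
      deriv (fun s => k (p.1, s)) p.2 = dirDeriv (0, 1) k p := fun p hp =>
    ((hp.differentiableAt (by simp)).hasFDerivAt.comp_hasDerivAt p.2
      ((hasDerivAt_const p.2 p.1).prodMk (hasDerivAt_id p.2))).deriv
  have h2 : ∀ p : ℝ × ℝ, ContDiffAt ℝ ∞ k p →
      deriv (fun ε => k (ε, p.2)) p.1 = dirDeriv (1, 0) k p := fun p hp =>
    ((hp.differentiableAt (by simp)).hasFDerivAt.comp_hasDerivAt p.1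
      ((hasDerivAt_id p.1).prodMk (hasDerivAt_const p.1 p.2))).deriv
  have hat := hk.self_of_nhds
  have e1 : (fun ε => deriv (fun s => k (ε, s)) t) =ᶠ[𝓝 a] fun ε => dirDeriv (0, 1) k (ε, t) :=
    ((Continuous.prodMk_left t).continuousAt.eventually hk).mono fun ε hε => h1 (ε, t) hε
  have e2 : (fun s => deriv (fun ε => k (ε, s)) a) =ᶠ[𝓝 t] fun s => dirDeriv (1, 0) k (a, s) :=
    ((Continuous.prodMk_right a).continuousAt.eventually hk).mono fun s hs => h2 (a, s) hs
  have d1 := ((contDiffAt_dirDeriv hat (0, 1)).differentiableAt (by simp)).hasFDerivAt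
  have d2 := ((contDiffAt_dirDeriv hat (1, 0)).differentiableAt (by simp)).hasFDerivAt
  rw [e2.deriv_eq, show deriv (fun s => dirDeriv (1, 0) k (a, s)) t = _ from
    (d2.comp_hasDerivAt t ((hasDerivAt_const t a).prodMk (hasDerivAt_id t))).deriv]
  refine HasDerivAt.congr_of_eventuallyEq ?_ e1
  refine (d1.comp_hasDerivAt a ((hasDerivAt_id a).prodMk (hasDerivAt_const a t))).congr_deriv ?_
  exact dirDeriv_comm hat (1, 0) (0, 1)

variable {d : ℕ} {M : Type*} [TopologicalSpace M] [ChartedSpace (EuclideanSpace ℝ (Fin d)) M]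
  {g : ℝ × M → ℝ} {a : ℝ} {q : M}

/-- The `ε`-derivative of a smooth function `g (ε, y)`, read in a chart. -/
theorem deriv_param_comp_symm {e : OpenPartialHomeomorph M (EuclideanSpace ℝ (Fin d))}
    (he : e ∈ IsManifold.maximalAtlas (𝓡 d) ∞ M) (hq : q ∈ e.source)
    (hg : ContMDiffAt (𝓘(ℝ, ℝ).prod (𝓡 d)) 𝓘(ℝ, ℝ) ∞ g (a, q)) :
    (fun y => deriv (fun ε => g (ε, y)) a) ∘ e.symm =ᶠ[𝓝 (e q)]
      dirDeriv (1, 0) (fun z : ℝ × EuclideanSpace ℝ (Fin d) => g (z.1, e.symm z.2)) ∘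
        fun x => (a, x) := by
  have h1 := contDiffAt_comp_symm_snd he hq hg
  filter_upwards [(Continuous.prodMk_right a).continuousAt.eventually
    (eventually_differentiableAt_of_contDiffAt h1)] with x hx
  exact (hx.hasFDerivAt.comp_hasDerivAt a ((hasDerivAt_id a).prodMk (hasDerivAt_const a x))).deriv

theorem contMDiffAt_deriv_param {e : OpenPartialHomeomorph M (EuclideanSpace ℝ (Fin d))}
    (he : e ∈ IsManifold.maximalAtlas (𝓡 d) ∞ M) (hq : q ∈ e.source)
    (hg : ContMDiffAt (𝓘(ℝ, ℝ).prod (𝓡 d)) 𝓘(ℝ, ℝ) ∞ g (a, q)) :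
    ContMDiffAt (𝓡 d) 𝓘(ℝ, ℝ) ∞ (fun y => deriv (fun ε => g (ε, y)) a) q := by
  refine contMDiffAt_of_comp_symm he hq (ContDiffAt.congr_of_eventuallyEq ?_
    (deriv_param_comp_symm he hq hg))
  exact (contDiffAt_dirDeriv (contDiffAt_comp_symm_snd he hq hg) _).comp (e q)
    (contDiffAt_const.prodMk contDiffAt_id)

theorem hasDerivAt_comp_prodMk_left {E : Type*} [NormedAddCommGroup E] [NormedSpace ℝ E]
    {u : ℝ × E → ℝ} {a : ℝ} {x : E} (hu : ContDiffAt ℝ ∞ u (a, x)) :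
    HasDerivAt (fun ε => u (ε, x)) (dirDeriv (1, 0) u (a, x)) a :=
  (hu.differentiableAt (by simp)).hasFDerivAt.comp_hasDerivAt a
    ((hasDerivAt_id a).prodMk (hasDerivAt_const a x))

/-- The parameter derivative commutes with `∂/∂x^i`.  Smoothness is required on a neighbourhood, as
`C^∞` regularity at a point does not propagate to nearby points. -/
theorem hasDerivAt_pd {e : OpenPartialHomeomorph M (EuclideanSpace ℝ (Fin d))}
    (he : e ∈ IsManifold.maximalAtlas (𝓡 d) ∞ M) (hq : q ∈ e.source)
    (hg : ∀ᶠ p in 𝓝 (a, q), ContMDiffAt (𝓘(ℝ, ℝ).prod (𝓡 d)) 𝓘(ℝ, ℝ) ∞ g p) (i : Fin d) :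
    HasDerivAt (fun ε => pd e i (fun y => g (ε, y)) q)
      (pd e i (fun y => deriv (fun ε => g (ε, y)) a) q) a := by
  set u : ℝ × EuclideanSpace ℝ (Fin d) → ℝ := fun z => g (z.1, e.symm z.2) with hu
  have hus : ∀ ε, ContMDiffAt (𝓘(ℝ, ℝ).prod (𝓡 d)) 𝓘(ℝ, ℝ) ∞ g (ε, q) →
    ContDiffAt ℝ ∞ u (ε, e q) := fun ε hε => contDiffAt_comp_symm_snd he hq hε
  have hat := hus a hg.self_of_nhds
  have e1 : (fun ε => pd e i (fun y => g (ε, y)) q) =ᶠ[𝓝 a]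
      fun ε => dirDeriv (0, EuclideanSpace.single i 1) u (ε, e q) := by
    filter_upwards [(Continuous.prodMk_left q).continuousAt.eventually hg] with ε hε
    exact (dirDeriv_slice (hasFDerivAt_prodMk_right ε) (hus ε hε) _).eq_of_nhds
  have e2 : pd e i (fun y => deriv (fun ε => g (ε, y)) a) q =
      dirDeriv (1, 0) (dirDeriv (0, EuclideanSpace.single i 1) u) (a, e q) := by
    have h1 := (dirDeriv_congr (deriv_param_comp_symm he hq hg.self_of_nhds)
      (EuclideanSpace.single i (1 : ℝ))).eq_of_nhds
    rw [dirDeriv_comm hat]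
    refine h1.trans ?_
    exact (dirDeriv_slice (hasFDerivAt_prodMk_right a) (contDiffAt_dirDeriv hat _) _).eq_of_nhds
  rw [e2]
  exact (hasDerivAt_comp_prodMk_left (contDiffAt_dirDeriv hat _)).congr_of_eventuallyEq e1

theorem hasDerivAt_pd_pd {e : OpenPartialHomeomorph M (EuclideanSpace ℝ (Fin d))}
    (he : e ∈ IsManifold.maximalAtlas (𝓡 d) ∞ M) (hq : q ∈ e.source)
    (hg : ∀ᶠ p in 𝓝 (a, q), ContMDiffAt (𝓘(ℝ, ℝ).prod (𝓡 d)) 𝓘(ℝ, ℝ) ∞ g p) (j k : Fin d) :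
    HasDerivAt (fun ε => pd e j (pd e k fun y => g (ε, y)) q)
      (pd e j (pd e k fun y => deriv (fun ε => g (ε, y)) a) q) a := by
  set u : ℝ × EuclideanSpace ℝ (Fin d) → ℝ := fun z => g (z.1, e.symm z.2) with hu
  have hus : ∀ ε, ContMDiffAt (𝓘(ℝ, ℝ).prod (𝓡 d)) 𝓘(ℝ, ℝ) ∞ g (ε, q) →
    ContDiffAt ℝ ∞ u (ε, e q) := fun ε hε => contDiffAt_comp_symm_snd he hq hε
  have hat := hus a hg.self_of_nhds
  have hev : ∀ᶠ z in 𝓝 (a, e q), ContDiffAt ℝ ∞ u z := by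
    have h1 : Filter.Tendsto (fun z : ℝ × EuclideanSpace ℝ (Fin d) => (z.1, e.symm z.2))
        (𝓝 (a, e q)) (𝓝 (a, q)) := by
      have h2 : ContinuousAt (fun z : ℝ × EuclideanSpace ℝ (Fin d) => (z.1, e.symm z.2))
          (a, e q) := continuousAt_fst.prodMk
        (ContinuousAt.comp (g := e.symm) (e.continuousAt_symm (e.map_source hq)) continuousAt_snd)
      simpa [ContinuousAt, e.left_inv hq] using h2
    filter_upwards [h1.eventually hg, continuousAt_snd.eventually
      (e.open_target.mem_nhds (e.map_source hq))] with z hz hz'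
    have := contDiffAt_comp_symm_snd he (e.map_target hz') hz
    rwa [e.right_inv hz'] at this
  have e1 : (fun ε => pd e j (pd e k fun y => g (ε, y)) q) =ᶠ[𝓝 a]
      fun ε => dirDeriv (0, EuclideanSpace.single j 1)
        (dirDeriv (0, EuclideanSpace.single k 1) u) (ε, e q) := by
    filter_upwards [(Continuous.prodMk_left q).continuousAt.eventually hg] with ε hε
    rw [pd_pd hq]
    exact dirDeriv_dirDeriv_slice (hasFDerivAt_prodMk_right ε) (hus ε hε) _ _
  have e2 : pd e j (pd e k fun y => deriv (fun ε => g (ε, y)) a) q =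
      dirDeriv (1, 0) (dirDeriv (0, EuclideanSpace.single j 1)
        (dirDeriv (0, EuclideanSpace.single k 1) u)) (a, e q) := by
    have h1 := (dirDeriv_congr (dirDeriv_congr (deriv_param_comp_symm he hq hg.self_of_nhds)
      (EuclideanSpace.single k (1 : ℝ))) (EuclideanSpace.single j (1 : ℝ))).eq_of_nhds
    have h2 := dirDeriv_dirDeriv_slice (hasFDerivAt_prodMk_right a)
      (contDiffAt_dirDeriv hat (1, 0)) (EuclideanSpace.single j (1 : ℝ))
      (EuclideanSpace.single k (1 : ℝ))
    rw [pd_pd hq, dirDeriv_comm (contDiffAt_dirDeriv hat _)]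
    refine (h1.trans h2).trans (dirDeriv_congr ?_ _).eq_of_nhds
    filter_upwards [hev] with z hz
    exact dirDeriv_comm hz _ _
  rw [e2]
  exact (hasDerivAt_comp_prodMk_left (contDiffAt_dirDeriv (contDiffAt_dirDeriv hat _) _)
    ).congr_of_eventuallyEq e1

variable [IsManifold (𝓡 d) ∞ M]

theorem EllipticVector.hasDerivAt_apply (A : EllipticVector d)
    (hg : ∀ᶠ p in 𝓝 (a, q), ContMDiffAt (𝓘(ℝ, ℝ).prod (𝓡 d)) 𝓘(ℝ, ℝ) ∞ g p) :
    HasDerivAt (fun ε => A.apply q fun y => g (ε, y))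
      (A.apply q fun y => deriv (fun ε => g (ε, y)) a) a := by
  have hq := mem_chart_source (EuclideanSpace ℝ (Fin d)) q
  have he := IsManifold.chart_mem_maximalAtlas (I := 𝓡 d) (n := ∞) q
  exact (HasDerivAt.fun_sum fun i _ => (hasDerivAt_pd he hq hg i).const_mul _).add
    ((HasDerivAt.fun_sum fun j _ => HasDerivAt.fun_sum fun k _ =>
      (hasDerivAt_pd_pd he hq hg j k).const_mul _).const_mul _)

theorem EllipticVector.hasDerivAt_squaredField (A : EllipticVector d) {g' : ℝ × M → ℝ}
    (hg : ∀ᶠ p in 𝓝 (a, q), ContMDiffAt (𝓘(ℝ, ℝ).prod (𝓡 d)) 𝓘(ℝ, ℝ) ∞ g p)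
    (hg' : ∀ᶠ p in 𝓝 (a, q), ContMDiffAt (𝓘(ℝ, ℝ).prod (𝓡 d)) 𝓘(ℝ, ℝ) ∞ g' p) :
    HasDerivAt (fun ε => A.squaredField q (fun y => g (ε, y)) fun y => g' (ε, y))
      (A.squaredField q (fun y => deriv (fun ε => g (ε, y)) a) (fun y => g' (a, y)) +
        A.squaredField q (fun y => g (a, y)) fun y => deriv (fun ε => g' (ε, y)) a) a := by
  have hq := mem_chart_source (EuclideanSpace ℝ (Fin d)) q
  have he := IsManifold.chart_mem_maximalAtlas (I := 𝓡 d) (n := ∞) q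
  have h1 := HasDerivAt.fun_sum (u := Finset.univ) fun j _ =>
    HasDerivAt.fun_sum (u := Finset.univ) fun k _ =>
      ((hasDerivAt_pd he hq hg j).const_mul (A.a j k)).mul (hasDerivAt_pd he hq hg' k)
  refine h1.congr_deriv ?_
  simp only [Finset.sum_add_distrib]
  rfl

/-- `Γ_A(f, f') = ∂_i f Γ_A(x^i, f')` in any chart `(x^i)`. -/
theorem EllipticVector.squaredField_eq_sum_pd (A : EllipticVector d)
    {e : OpenPartialHomeomorph M (EuclideanSpace ℝ (Fin d))}
    (he : e ∈ IsManifold.maximalAtlas (𝓡 d) ∞ M) (hq : q ∈ e.source) {f : M → ℝ}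
    (hf : ContMDiffAt (𝓡 d) 𝓘(ℝ, ℝ) ∞ f q) (f' : M → ℝ) :
    A.squaredField q f f' = ∑ i, pd e i f q * A.squaredField q (fun p => e p i) f' := by
  have hq' := mem_chart_source (EuclideanSpace ℝ (Fin d)) q
  have he' := IsManifold.chart_mem_maximalAtlas (I := 𝓡 d) (n := ∞) q
  have hev : f =ᶠ[𝓝 q] (f ∘ e.symm) ∘ e := by
    filter_upwards [e.open_source.mem_nhds hq] with y hy
    simp [e.left_inv hy]
  have h1 : ∀ j, pd (chartAt (EuclideanSpace ℝ (Fin d)) q) j f q =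
      ∑ l, pd e l f q * pd (chartAt (EuclideanSpace ℝ (Fin d)) q) j (fun p => e p l) q := by
    intro j
    rw [pd_congr hq' hev]
    exact pd_comp he' hq' (contMDiffAt_of_mem_maximalAtlas he hq) (contDiffAt_comp_symm he hq hf) j
  simp only [squaredField, h1, Finset.mul_sum, Finset.sum_mul]
  calc _ = ∑ j, ∑ l, ∑ k, _ := Finset.sum_congr rfl fun j _ => Finset.sum_comm
    _ = ∑ l, ∑ j, ∑ k, _ := Finset.sum_comm
    _ = _ := Finset.sum_congr rfl fun l _ => Finset.sum_congr rfl fun j _ =>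
      Finset.sum_congr rfl fun k _ => by ring

end Parameter

/-! ### The flow of a projectable vector field -/

section Flow

variable {d : ℕ} {M : Type*} [TopologicalSpace M] [ChartedSpace (EuclideanSpace ℝ (Fin d)) M]
  {V : (p : ℝ × M) → TangentSpace (𝓘(ℝ, ℝ).prod (𝓡 d)) p} {ψ : ℝ → ℝ × M → ℝ × M}

theorem IsCompleteWithFlow.smooth_apply (h : IsCompleteWithFlow V ψ) (ε : ℝ) :
    ContMDiff (𝓘(ℝ, ℝ).prod (𝓡 d)) (𝓘(ℝ, ℝ).prod (𝓡 d)) ∞ (ψ ε) :=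
  h.smooth.comp (contMDiff_const.prodMk contMDiff_id)

theorem IsCompleteWithFlow.neg_apply (h : IsCompleteWithFlow V ψ) (ε : ℝ) (p : ℝ × M) :
    ψ (-ε) (ψ ε p) = p := by
  rw [← h.add, neg_add_cancel, h.zero]

theorem IsCompleteWithFlow.apply_neg (h : IsCompleteWithFlow V ψ) (ε : ℝ) (p : ℝ × M) :
    ψ ε (ψ (-ε) p) = p := by
  rw [← h.add, add_neg_cancel, h.zero]

theorem IsCompleteWithFlow.contDiff_time (h : IsCompleteWithFlow V ψ) (q : M) :
    ContDiff ℝ ∞ fun z : ℝ × ℝ => (ψ z.1 (z.2, q)).1 := by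
  rw [← contMDiff_iff_contDiff]
  exact contMDiff_fst.comp (h.smooth.comp (contDiff_fst.contMDiff.prodMk
    (contDiff_snd.contMDiff.prodMk contMDiff_const)))

/-- Each `ψ_ε` covers an increasing diffeomorphism of the time axis: for `s < t` the difference of
the times of `ψ_ε (t, q)` and `ψ_ε (s, q)` never vanishes, and it is positive for `ε = 0`. -/
theorem IsCompleteWithFlow.exists_isBundleDiffeo [Nonempty M] (h : IsCompleteWithFlow V ψ)
    (hproj : IsProjectable ψ) (ε : ℝ) :
    ∃ F₀ : ℝ ≃o ℝ, IsBundleDiffeo (d := d) (ψ ε) (ψ (-ε)) F₀ := by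
  obtain ⟨q⟩ := ‹Nonempty M›
  set T : ℝ → ℝ → ℝ := fun ε t => (ψ ε (t, q)).1 with hT
  have hfst : ∀ ε p, (ψ ε p).1 = T ε p.1 := by
    intro ε p
    obtain ⟨F, hF⟩ := hproj ε
    rw [hF, hT]
    simp only [hF]
  have hneg : ∀ ε t, T (-ε) (T ε t) = t := fun ε t => by
    rw [← hfst (-ε) (ψ ε (t, q)), h.neg_apply]
  have hsm : ∀ ε, ContDiff ℝ ∞ (T ε) := fun ε =>
    (h.contDiff_time q).comp (contDiff_const.prodMk contDiff_id)
  have hmono : ∀ ε, StrictMono (T ε) := by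
    intro ε s t hst
    have hcont : Continuous fun ε => T ε t - T ε s := by
      have hc : ∀ r, Continuous fun ε => T ε r := fun r =>
        (h.contDiff_time q).continuous.comp (Continuous.prodMk_left r)
      exact (hc t).sub (hc s)
    have h0 : T 0 t - T 0 s = t - s := by simp [hT, h.zero]
    by_contra hle
    rw [not_lt] at hle
    obtain ⟨δ, hδ⟩ : (0 : ℝ) ∈ Set.range fun ε => T ε t - T ε s :=
      mem_range_of_exists_le_of_exists_ge hcont ⟨ε, by linarith⟩ ⟨0, by rw [h0]; linarith⟩
    have := congrArg (T (-δ)) (sub_eq_zero.1 hδ)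
    rw [hneg, hneg] at this
    exact hst.ne' this
  have hinv : ∀ t, T ε (T (-ε) t) = t := fun t => by simpa using hneg (-ε) t
  refine ⟨(hmono ε).orderIsoOfRightInverse (T ε) (T (-ε)) hinv, ?_⟩
  exact
    { smooth := h.smooth_apply ε
      smooth_inv := h.smooth_apply (-ε)
      left_inv := h.neg_apply ε
      right_inv := h.apply_neg ε
      smooth_time := hsm ε
      smooth_time_symm := hsm (-ε)
      fst_eq := hfst ε }

/-- `d/dε G(ψ_ε p) = dG(V)` at `ε = 0`. -/
theorem IsCompleteWithFlow.hasDerivAt_comp (h : IsCompleteWithFlow V ψ) {G : ℝ × M → ℝ} {p : ℝ × M}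
    (hG : MDifferentiableAt (𝓘(ℝ, ℝ).prod (𝓡 d)) 𝓘(ℝ, ℝ) G p) :
    HasDerivAt (fun ε => G (ψ ε p)) (mfderiv (𝓘(ℝ, ℝ).prod (𝓡 d)) 𝓘(ℝ, ℝ) G p (V p)) 0 := by
  have key : ∀ p', ψ 0 p = p' →
      HasDerivAt (fun ε => G (ψ ε p)) (mfderiv (𝓘(ℝ, ℝ).prod (𝓡 d)) 𝓘(ℝ, ℝ) G p' (V p')) 0 := by
    rintro p' rfl
    have hG' : MDifferentiableAt (𝓘(ℝ, ℝ).prod (𝓡 d)) 𝓘(ℝ, ℝ) G (ψ 0 p) := by rwa [h.zero]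
    obtain ⟨T, hT, h1⟩ : ∃ T : ℝ →L[ℝ] ℝ,
        T 1 = mfderiv (𝓘(ℝ, ℝ).prod (𝓡 d)) 𝓘(ℝ, ℝ) G (ψ 0 p) (V (ψ 0 p)) ∧
        HasFDerivAt (fun ε => G (ψ ε p)) T 0 := by
      refine ⟨_, ?_, (hG'.hasMFDerivAt.comp (0 : ℝ) (h.integralCurve p 0)).hasFDerivAt⟩
      change mfderiv (𝓘(ℝ, ℝ).prod (𝓡 d)) 𝓘(ℝ, ℝ) G (ψ 0 p) ((1 : ℝ) • V (ψ 0 p)) = _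
      rw [one_smul]
    exact h1.hasDerivAt.congr_deriv hT
  exact key p (h.zero p)

theorem IsCompleteWithFlow.hasDerivAt_time (h : IsCompleteWithFlow V ψ) (p : ℝ × M) :
    HasDerivAt (fun ε => (ψ ε p).1) (V p).1 0 := by
  have := h.hasDerivAt_comp (G := Prod.fst) (p := p) mdifferentiableAt_fst
  rw [mfderiv_fst] at this
  exact this

theorem IsCompleteWithFlow.hasDerivAt_coord (h : IsCompleteWithFlow V ψ)
    {e : OpenPartialHomeomorph M (EuclideanSpace ℝ (Fin d))}
    (he : e ∈ IsManifold.maximalAtlas (𝓡 d) ∞ M) {p : ℝ × M} (hp : p.2 ∈ e.source) (i : Fin d) :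
    HasDerivAt (fun ε => e (ψ ε p).2 i) (component V e i p) 0 := by
  have h1 : ContMDiffAt (𝓘(ℝ, ℝ).prod (𝓡 d)) 𝓘(ℝ, ℝ) ∞ (fun p' : ℝ × M => e p'.2 i) p :=
    contMDiffAt_coord (h := fun p' : ℝ × M => e p'.2) (ContMDiffAt.comp (g := e) p
      (contMDiffAt_of_mem_maximalAtlas he hp) contMDiffAt_snd) i
  exact h.hasDerivAt_comp (h1.mdifferentiableAt (by simp))

end Flow

/-! ### Prolongation of bundle diffeomorphisms -/

section Prolongation

variable {d : ℕ} {M : Type*} [TopologicalSpace M] [ChartedSpace (EuclideanSpace ℝ (Fin d)) M]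

theorem stochEquiv_of_meanDeriv_eq {X Y : Diffusion d M} (ht : X.proc.t₀ = Y.proc.t₀)
    (hq : X.q = Y.q) (h : X.meanDeriv = Y.meanDeriv) : stochEquiv d M X Y :=
  ⟨ht, hq, fun f _ => by rw [Diffusion.meanDerivComp, Diffusion.meanDerivComp, h, hq]⟩

theorem isStochasticProlongation_unique {F : ℝ × M → ℝ × M} {jF jF' : Jet d M → Jet d M}
    (h : IsStochasticProlongation F jF) (h' : IsStochasticProlongation F jF') : jF = jF' := by
  obtain ⟨F₀, -, -, hfst, hX⟩ := h
  obtain ⟨F₁, -, -, hfst', hX'⟩ := h'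
  funext ξ
  induction ξ using Quotient.ind with
  | _ X =>
    obtain rfl : F₀ = F₁ := by
      ext t
      rw [← hfst (t, X.q), hfst']
    exact (hX X).choose_spec.trans (hX' X).choose_spec.symm

/-- Over the empty manifold there are no diffusions, and the change of time is arbitrary. -/
theorem isStochasticProlongation_of_isEmpty [IsEmpty M] {F : ℝ × M → ℝ × M} :
    IsStochasticProlongation F (id : Jet d M → Jet d M) :=
  ⟨OrderIso.refl ℝ, contDiff_id, contDiff_id, fun p => isEmptyElim p.2, fun X => isEmptyElim X.q⟩

variable [T2Space M] [IsManifold (𝓡 d) ∞ M] {F Finv : ℝ × M → ℝ × M} {F₀ : ℝ ≃o ℝ}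

/-- The change of time in the definition of a prolongation is determined by `F`, as `M` is not
empty. -/
theorem IsBundleDiffeo.isStochasticProlongation_iff [Nonempty M]
    (hF : IsBundleDiffeo (d := d) F Finv F₀) {jF : Jet d M → Jet d M} :
    IsStochasticProlongation F jF ↔ ∀ X : Diffusion d M, jF (jet X) = jet (hF.pushforward X) := by
  constructor
  · rintro ⟨F₁, -, -, hfst, hX⟩ X
    obtain rfl : F₁ = F₀ := by
      obtain ⟨q⟩ := ‹Nonempty M›
      ext t
      rw [← hfst (t, q), hF.fst_eq]
    exact (hX X).choose_spec
  · intro h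
    exact ⟨F₀, hF.smooth_time, hF.smooth_time_symm, hF.fst_eq, fun X =>
      ⟨hF.isDiffusionFrom_pushforward X.isDiffusionFrom, h X⟩⟩

theorem IsBundleDiffeo.exists_isStochasticProlongation [Nonempty M]
    (hF : IsBundleDiffeo (d := d) F Finv F₀) : ∃ jF : Jet d M → Jet d M,
      IsStochasticProlongation F jF := by
  refine ⟨Quotient.lift (fun X => jet (hF.pushforward X)) fun X Y h => ?_,
    hF.isStochasticProlongation_iff.2 fun X => rfl⟩
  have hvec : X.meanDeriv = Y.meanDeriv :=
    congrArg Jet.vec (Quotient.sound h : jet X = jet Y)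
  have ht : X.proc.t₀ = Y.proc.t₀ := h.1
  have hq : X.q = Y.q := h.2.1
  refine Quotient.sound (stochEquiv_of_meanDeriv_eq (congrArg F₀ ht) ?_ ?_)
  · change (F (X.proc.t₀, X.q)).2 = (F (Y.proc.t₀, Y.q)).2
    rw [ht, hq]
  · rw [hF.meanDeriv_pushforward, hF.meanDeriv_pushforward, hvec, ht, hq]

/-- The identity, written as a bundle diffeomorphism, fixes every jet. -/
theorem IsBundleDiffeo.jet_pushforward_of_forall_eq (hF : IsBundleDiffeo (d := d) F Finv F₀)
    (hid : ∀ p, F p = p) (X : Diffusion d M) : jet (hF.pushforward X) = jet X := by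
  have hF₀ : ∀ s, F₀ s = s := fun s => by rw [← hF.fst_eq (s, X.q), hid]
  have hd : deriv F₀ X.proc.t₀ = 1 := by rw [show (F₀ : ℝ → ℝ) = id from funext hF₀, deriv_id]
  have hq : (hF.pushforward X).q = X.q := congrArg Prod.snd (hid (X.proc.t₀, X.q))
  refine Quotient.sound (stochEquiv_of_meanDeriv_eq (hF₀ _) hq ?_)
  rw [hF.meanDeriv_pushforward]
  refine EllipticVector.eq_of_apply_eq (q := X.q) fun f hf => ?_
  have := EllipticVector.transport_apply hF X.meanDeriv (t := X.proc.t₀) (x := X.q)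
    (g := fun p => f p.2) (hf.comp contMDiff_snd).contMDiffAt
  simpa only [hid, hd, deriv_const, zero_add, one_mul] using this

/-- Action of a prolongation on the coordinates `D^i x`:
`F₀' D^i x (jF ξ) = (∂_t + A)(x^i ∘ F)`. -/
theorem IsBundleDiffeo.D_jet_pushforward (hF : IsBundleDiffeo (d := d) F Finv F₀)
    (X : Diffusion d M) {e : OpenPartialHomeomorph M (EuclideanSpace ℝ (Fin d))}
    (he : e ∈ IsManifold.maximalAtlas (𝓡 d) ∞ M) (hq : (F (X.proc.t₀, X.q)).2 ∈ e.source)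
    (i : Fin d) :
    deriv F₀ X.proc.t₀ * (jet (hF.pushforward X)).D e i =
      deriv (fun s => e (F (s, X.q)).2 i) X.proc.t₀ +
        X.meanDeriv.apply X.q fun y => e (F (X.proc.t₀, y)).2 i := by
  have hD : (jet (hF.pushforward X)).D e i = (X.meanDeriv.transport X.proc.t₀ X.q F F₀).apply
      (F (X.proc.t₀, X.q)).2 fun p => e p i := by
    rw [← hF.meanDeriv_pushforward]
    rfl
  have hg : ContMDiffAt (𝓘(ℝ, ℝ).prod (𝓡 d)) 𝓘(ℝ, ℝ) ∞ (fun p : ℝ × M => e p.2 i)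
      (F (X.proc.t₀, X.q)) :=
    contMDiffAt_coord (h := fun p : ℝ × M => e p.2) (ContMDiffAt.comp (g := e) _
      (contMDiffAt_of_mem_maximalAtlas he hq) contMDiffAt_snd) i
  have := EllipticVector.transport_apply hF X.meanDeriv hg
  simpa only [deriv_const, zero_add, ← hD] using this

/-- Action of a prolongation on the coordinates `Q^{jk} x`:
`F₀' Q^{jk} x (jF ξ) = Γ_A(x^j ∘ F, x^k ∘ F)`. -/
theorem IsBundleDiffeo.Q_jet_pushforward (hF : IsBundleDiffeo (d := d) F Finv F₀)
    (X : Diffusion d M) {e : OpenPartialHomeomorph M (EuclideanSpace ℝ (Fin d))}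
    (he : e ∈ IsManifold.maximalAtlas (𝓡 d) ∞ M) (hq : (F (X.proc.t₀, X.q)).2 ∈ e.source)
    (j k : Fin d) :
    deriv F₀ X.proc.t₀ * (jet (hF.pushforward X)).Q e j k =
      X.meanDeriv.squaredField X.q (fun y => e (F (X.proc.t₀, y)).2 j)
        fun y => e (F (X.proc.t₀, y)).2 k := by
  have hQ : (jet (hF.pushforward X)).Q e j k =
      (X.meanDeriv.transport X.proc.t₀ X.q F F₀).squaredField
        (F (X.proc.t₀, X.q)).2 (fun p => e p j) fun p => e p k := by
    rw [← hF.meanDeriv_pushforward]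
    rfl
  have hg : ∀ i, ContMDiffAt (𝓡 d) 𝓘(ℝ, ℝ) ∞ (fun p => e p i) (F (X.proc.t₀, X.q)).2 :=
    contMDiffAt_coord (contMDiffAt_of_mem_maximalAtlas he hq)
  rw [hQ]
  exact EllipticVector.transport_squaredField hF X.meanDeriv (hg j) (hg k)

end Prolongation

/-! ### The prolongation formulae -/

section Velocity

variable {d : ℕ} {M : Type*} [TopologicalSpace M] [T2Space M]
  [ChartedSpace (EuclideanSpace ℝ (Fin d)) M] [IsManifold (𝓡 d) ∞ M]
  {V : (p : ℝ × M) → TangentSpace (𝓘(ℝ, ℝ).prod (𝓡 d)) p} {ψ : ℝ → ℝ × M → ℝ × M}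

/-- The derivative at `0` of `D = N / α` when `α 0 = 1`; here `α` is the time derivative `F₀'` of the
change of time, and `D` a jet coordinate. -/
theorem hasDerivAt_inv_mul {α N : ℝ → ℝ} {α' N' : ℝ} (hα : HasDerivAt α α' 0)
    (hN : HasDerivAt N N' 0) (h1 : α 0 = 1) {D : ℝ → ℝ} (hpos : ∀ ε, α ε ≠ 0)
    (hD : ∀ᶠ ε in 𝓝 0, α ε * D ε = N ε) : HasDerivAt D (N' - α' * D 0) 0 := by
  have h0 := hD.self_of_nhds
  rw [h1, one_mul] at h0
  have hev : D =ᶠ[𝓝 0] fun ε => N ε / α ε := by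
    filter_upwards [hD] with ε hε
    rw [← hε, mul_div_cancel_left₀ _ (hpos ε)]
  refine ((hN.div hα (hpos 0)).congr_deriv ?_).congr_of_eventuallyEq hev
  rw [h1, h0]
  ring

theorem IsCompleteWithFlow.hasVelocity (h : IsCompleteWithFlow V ψ) (hproj : IsProjectable ψ)
    {V₀ : ℝ → ℝ} (hV₀ : ∀ p : ℝ × M, (V p).1 = V₀ p.1) {jψ : ℝ → Jet d M → Jet d M}
    (hjψ : ∀ ε, IsStochasticProlongation (ψ ε) (jψ ε))
    {e : OpenPartialHomeomorph M (EuclideanSpace ℝ (Fin d))}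
    (he : e ∈ IsManifold.maximalAtlas (𝓡 d) ∞ M) {ξ : Jet d M} (hξ : ξ.point ∈ e.source) :
    HasVelocity e (fun ε => jψ ε ξ) ξ (V₀ ξ.time)
      (fun i => component V e i (ξ.time, ξ.point))
      (fun i => totalMeanDeriv (component V e i) ξ - deriv V₀ ξ.time * ξ.D e i)
      (fun j k =>
        ∑ i, pd e i (fun y => component V e j (ξ.time, y)) ξ.point * ξ.Q e i k +
        ∑ i, pd e i (fun y => component V e k (ξ.time, y)) ξ.point * ξ.Q e i j -
        deriv V₀ ξ.time * ξ.Q e j k) := by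
  induction ξ using Quotient.ind with
  | _ X =>
  change X.q ∈ e.source at hξ
  have : Nonempty M := ⟨X.q⟩
  choose F₀ hF using h.exists_isBundleDiffeo hproj
  have hj : ∀ ε, jψ ε (jet X) = jet ((hF ε).pushforward X) := fun ε =>
    (hF ε).isStochasticProlongation_iff.1 (hjψ ε) X
  set t := X.proc.t₀ with ht
  set q := X.q with hqdef
  set A := X.meanDeriv with hA
  have hpoint : ∀ ε, (jψ ε (jet X)).point = (ψ ε (t, q)).2 := fun ε => by rw [hj]; rfl
  have htime : ∀ ε, (jψ ε (jet X)).time = (ψ ε (t, q)).1 := fun ε => by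
    rw [hj, (hF ε).fst_eq]; rfl
  have hpos : jψ 0 (jet X) = jet X := by
    rw [hj]
    exact (hF 0).jet_pushforward_of_forall_eq h.zero X
  -- the chart coordinates of the flow are smooth near `ε = 0`
  have hcont : Continuous fun p : ℝ × ℝ × M => (ψ p.1 p.2).2 :=
    continuous_snd.comp h.smooth.continuous
  have hmem : ∀ᶠ p : ℝ × ℝ × M in 𝓝 (0, t, q), (ψ p.1 p.2).2 ∈ e.source := by
    refine hcont.continuousAt.eventually (e.open_source.mem_nhds ?_)
    simpa only [h.zero] using hξ
  have hsm : ∀ᶠ p : ℝ × ℝ × M in 𝓝 (0, t, q), ∀ i : Fin d,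
      ContMDiffAt (𝓘(ℝ, ℝ).prod (𝓘(ℝ, ℝ).prod (𝓡 d))) 𝓘(ℝ, ℝ) ∞
        (fun p : ℝ × ℝ × M => e (ψ p.1 p.2).2 i) p := by
    filter_upwards [hmem] with p hp i
    refine contMDiffAt_coord (h := fun p : ℝ × ℝ × M => e (ψ p.1 p.2).2) ?_ i
    exact ContMDiffAt.comp (g := e) p (contMDiffAt_of_mem_maximalAtlas he hp)
      (contMDiff_snd.comp h.smooth).contMDiffAt
  set g : Fin d → ℝ × M → ℝ := fun i z => e (ψ z.1 (t, z.2)).2 i with hg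
  have hgs : ∀ i, ∀ᶠ z : ℝ × M in 𝓝 (0, q),
      ContMDiffAt (𝓘(ℝ, ℝ).prod (𝓡 d)) 𝓘(ℝ, ℝ) ∞ (g i) z := by
    intro i
    have hι : Continuous fun z : ℝ × M => (z.1, t, z.2) := by fun_prop
    filter_upwards [hι.continuousAt.eventually hsm] with z hz
    exact ContMDiffAt.comp (g := fun p : ℝ × ℝ × M => e (ψ p.1 p.2).2 i) z (hz i)
      (contMDiffAt_fst.prodMk (contMDiffAt_const.prodMk contMDiffAt_snd))
  set k : Fin d → ℝ × ℝ → ℝ := fun i z => e (ψ z.1 (z.2, q)).2 i with hk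
  have hks : ∀ i, ∀ᶠ z : ℝ × ℝ in 𝓝 (0, t), ContDiffAt ℝ ∞ (k i) z := by
    intro i
    have hι : Continuous fun z : ℝ × ℝ => (z.1, z.2, q) := by fun_prop
    filter_upwards [hι.continuousAt.eventually hsm] with z hz
    rw [← contMDiffAt_iff_contDiffAt]
    exact ContMDiffAt.comp (g := fun p : ℝ × ℝ × M => e (ψ p.1 p.2).2 i) z (hz i)
      (contDiff_fst.contMDiff.contMDiffAt.prodMk
        (contDiff_snd.contMDiff.contMDiffAt.prodMk contMDiffAt_const))
  -- their velocities are the components of `V`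
  have hcomp : ∀ i s y, y ∈ e.source →
      HasDerivAt (fun ε => e (ψ ε (s, y)).2 i) (component V e i (s, y)) 0 :=
    fun i s y hy => h.hasDerivAt_coord he (p := (s, y)) hy i
  have hgV : ∀ i, (fun y => deriv (fun ε => g i (ε, y)) 0) =ᶠ[𝓝 q]
      fun y => component V e i (t, y) := fun i => by
    filter_upwards [e.open_source.mem_nhds hξ] with y hy
    exact (hcomp i t y hy).deriv
  have hg0 : ∀ i, (fun y => g i (0, y)) = fun y => e y i := fun i => by
    funext y
    simp only [hg, h.zero]
  -- the derivative of the change of time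
  set α : ℝ → ℝ := fun ε => deriv (fun s => (ψ ε (s, q)).1) t with hα
  have hαF : ∀ ε, deriv (F₀ ε) t = α ε := fun ε => by
    simp only [hα, (hF ε).fst_eq]
  have hα0 : α 0 = 1 := by simp [hα, h.zero]
  have hαpos : ∀ ε, α ε ≠ 0 := fun ε => by
    rw [← hαF]
    exact (deriv_orderIso_pos (hF ε).smooth_time (hF ε).smooth_time_symm t).ne'
  have hαd : HasDerivAt α (deriv V₀ t) 0 := by
    refine (hasDerivAt_deriv_comm (k := fun z => (ψ z.1 (z.2, q)).1) (a := 0) (t := t)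
      (Filter.Eventually.of_forall fun z => (h.contDiff_time q).contDiffAt)).congr_deriv ?_
    congr 1
    funext s
    rw [(h.hasDerivAt_time (s, q)).deriv, hV₀]
  have hmem0 : ∀ᶠ ε in 𝓝 (0 : ℝ), (ψ ε (t, q)).2 ∈ e.source :=
    (Continuous.prodMk_left ((t, q) : ℝ × M)).continuousAt.eventually hmem
  refine ⟨hpos, ?_, ?_, fun i => ?_, fun i => ?_, fun j l => ?_⟩
  · filter_upwards [hmem0] with ε hε
    change (jψ ε (jet X)).point ∈ e.source
    rwa [hpoint]
  · change HasDerivAt (fun ε => (jψ ε (jet X)).time) (V₀ t) 0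
    simp only [htime]
    rw [← hV₀ (t, q)]
    exact h.hasDerivAt_time (t, q)
  · change HasDerivAt (fun ε => e (jψ ε (jet X)).point i) (component V e i (t, q)) 0
    simp only [hpoint]
    exact hcomp i t q hξ
  · have hN : HasDerivAt (fun ε => deriv (fun s => k i (ε, s)) t + A.apply q fun y => g i (ε, y))
        (totalMeanDeriv (component V e i) (jet X)) 0 := by
      refine ((hasDerivAt_deriv_comm (hks i)).add (A.hasDerivAt_apply (hgs i))).congr_deriv ?_
      rw [A.apply_congr (hgV i)]
      have : (fun s => deriv (fun ε => k i (ε, s)) 0) = fun s => component V e i (s, q) := by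
        funext s
        exact (hcomp i s q hξ).deriv
      rw [this]
      rfl
    have := hasDerivAt_inv_mul (D := fun ε => (jψ ε (jet X)).D e i) hαd hN hα0 hαpos (by
      filter_upwards [hmem0] with ε hε
      rw [← hαF, hj]
      exact (hF ε).D_jet_pushforward X he hε i)
    rw [hpos] at this
    exact this
  · have hN := A.hasDerivAt_squaredField (hgs j) (hgs l)
    have := hasDerivAt_inv_mul (D := fun ε => (jψ ε (jet X)).Q e j l) hαd hN hα0 hαpos (by
      filter_upwards [hmem0] with ε hε
      rw [← hαF, hj]
      exact (hF ε).Q_jet_pushforward X he hε j l)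
    rw [hpos] at this
    refine this.congr_deriv ?_
    have hVs : ∀ i, ContMDiffAt (𝓡 d) 𝓘(ℝ, ℝ) ∞ (fun y => component V e i (t, y)) q := fun i =>
      (contMDiffAt_deriv_param he hξ (hgs i).self_of_nhds).congr_of_eventuallyEq (hgV i).symm
    simp only [hg0]
    rw [A.squaredField_comm q (fun y => e y j),
      A.squaredField_congr (hgV j) Filter.EventuallyEq.rfl,
      A.squaredField_congr (hgV l) Filter.EventuallyEq.rfl,
      A.squaredField_eq_sum_pd he hξ (hVs j), A.squaredField_eq_sum_pd he hξ (hVs l)]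
    rfl

end Velocity

end StochProlong

theorem mainTheorem6 {d : ℕ} {M : Type*} [TopologicalSpace M] [T2Space M]
    [SecondCountableTopology M] [ChartedSpace (EuclideanSpace ℝ (Fin d)) M] [IsManifold (𝓡 d) ∞ M]
    (V : Cₛ^∞⟮𝓘(ℝ, ℝ).prod (𝓡 d); ℝ × EuclideanSpace ℝ (Fin d),
      (TangentSpace (𝓘(ℝ, ℝ).prod (𝓡 d)) : ℝ × M → Type _)⟯)
    (ψ : ℝ → ℝ × M → ℝ × M) (hflow : StochProlong.IsCompleteWithFlow (fun p => V p) ψ)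
    (hproj : StochProlong.IsProjectable ψ)
    (V₀ : ℝ → ℝ) (hV₀ : ∀ p : ℝ × M, (V p).1 = V₀ p.1) :
    (∀ ε, ∃! jF : StochProlong.Jet d M → StochProlong.Jet d M,
      StochProlong.IsStochasticProlongation (ψ ε) jF) ∧
    ∀ jψ : ℝ → StochProlong.Jet d M → StochProlong.Jet d M,
      (∀ ε, StochProlong.IsStochasticProlongation (ψ ε) (jψ ε)) →
      ∀ e ∈ IsManifold.maximalAtlas (𝓡 d) ∞ M,
      ∀ ξ : StochProlong.Jet d M, ξ.point ∈ e.source →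
        StochProlong.HasVelocity e (fun ε => jψ ε ξ) ξ
          (V₀ ξ.time)
          (fun i => StochProlong.component (fun p => V p) e i (ξ.time, ξ.point))
          (fun i => StochProlong.totalMeanDeriv (StochProlong.component (fun p => V p) e i) ξ -
            deriv V₀ ξ.time * ξ.D e i)
          (fun j k =>
            ∑ i, StochProlong.pd e i
              (fun y => StochProlong.component (fun p => V p) e j (ξ.time, y)) ξ.point * ξ.Q e i k +
            ∑ i, StochProlong.pd e i
              (fun y => StochProlong.component (fun p => V p) e k (ξ.time, y)) ξ.point * ξ.Q e i j -
            deriv V₀ ξ.time * ξ.Q e j k)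
 := by
  refine ⟨fun ε => ?_, fun jψ hjψ e he ξ hξ => hflow.hasVelocity hproj hV₀ hjψ he hξ⟩
  refine existsUnique_of_exists_of_unique ?_ fun jF jF' h h' =>
    StochProlong.isStochasticProlongation_unique h h'
  cases isEmpty_or_nonempty M with
  | inl _ => exact ⟨id, StochProlong.isStochasticProlongation_of_isEmpty⟩
  | inr _ =>
    obtain ⟨F₀, hF⟩ := hflow.exists_isBundleDiffeo hproj ε
    exact hF.exists_isStochasticProlongation
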